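/- Let $m,n\ge 1$ be integers, let $\mathbb F_n^+$ be the free semigroup on generators $g_1,\dots,g_n$ with unit $g_0$, and let $f=\sum_{\alpha\in\mathbb F_n^+}a_\alpha X_\alpha$ be a positive regular free holomorphic function on $\{X\in B(\mathcal H)^n:\ \|X_1X_1^*+\cdots+X_nX_n^*\|<\rho\}$ for some $\rho>0$ and some Hilbert space $\mathcal H\neq\{0\}$; that is, $a_\alpha\ge 0$ for all $\alpha$, $a_{g_0}=0$, $a_{g_i}>0$ for $i=1,\dots,n$, and $\sum_{k\ge0}\sum_{|\alpha|=k}a_\alpha X_\alpha$ converges in operator norm at every point of this ball. Put $b^{(m)}_{g_0}=1$ and $$b^{(m)}_\alpha=\sum_{j=1}^{|\alpha|}\ \sum_{\gamma_1\cdots\gamma_j=\alpha,\ |\gamma_i|\ge1}a_{\gamma_1}\cdots a_{\gamma_j}\binom{j+m-1}{m-1}\qquad(|\alpha|\ge1).$$ For $\mathbf k\in\mathbb N_0^n$ let $\Lambda_{\mathbf k}$ be the set of words in which each $g_i$ occurs exactly $k_i$ times, and let $\gamma^{(m)}_{\mathbf k}=\sum_{\alpha\in\Lambda_{\mathbf k}}b^{(m)}_\alpha$.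 Let $${\bf D}^1_{f,\circ}(\mathbb C)=\Big\{\lambda\in\mathbb C^n:\ \sum_{|\alpha|\ge1}a_\alpha|\lambda_\alpha|^2<1\Big\},$$ and let $H^2({\bf D}^1_{f,\circ}(\mathbb C))$ be the Hilbert space of all functions $\varphi$ on ${\bf D}^1_{f,\circ}(\mathbb C)$ that admit a power series representation $\varphi(\lambda)=\sum_{\mathbf k}c_{\mathbf k}\lambda^{\mathbf k}$ there with $\|\varphi\|_2^2=\sum_{\mathbf k}|c_{\mathbf k}|^2/\gamma^{(m)}_{\mathbf k}<\infty$. Let $H^\infty({\bf D}^1_{f,\circ}(\mathbb C))\subset B(H^2({\bf D}^1_{f,\circ}(\mathbb C)))$ be the algebra of all its multipliers, i.e. of all bounded operators of multiplication by a function on ${\bf D}^1_{f,\circ}(\mathbb C)$. On the full Fock space $F^2(H_n)$ with orthonormal basis $(e_\alpha)_{\alpha\in\mathbb F_n^+}$ let $W_ie_\alpha=\sqrt{b^{(m)}_\alpha/b^{(m)}_{g_i\alpha}}\;e_{g_i\alpha}$, let $F^2_s$ be the closed span of the vectors $w^{\mathbf k}=\frac1{\gamma^{(m)}_{\mathbf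 k}}\sum_{\alpha\in\Lambda_{\mathbf k}}\sqrt{b^{(m)}_\alpha}\,e_\alpha$, and let $L_i=P_{F^2_s}W_i|_{F^2_s}$, $i=1,\dots,n$. Then the map $U:\varphi\mapsto\big(\lambda\mapsto\sum_\alpha\langle\varphi,e_\alpha\rangle\sqrt{b^{(m)}_\alpha}\,\lambda_\alpha\big)$ is a unitary operator from $F^2_s$ onto $H^2({\bf D}^1_{f,\circ}(\mathbb C))$, under which $L_i$ becomes the operator of multiplication by the coordinate function $\lambda_i$. With this identification, the algebra $H^\infty({\bf D}^1_{f,\circ}(\mathbb C))$ is reflexive, i.e. it consists of all bounded operators on $H^2({\bf D}^1_{f,\circ}(\mathbb C))$ that leave invariant every closed subspace invariant under all of $H^\infty({\bf D}^1_{f,\circ}(\mathbb C))$, and it coincides with the smallest algebra of operators that contains $L_1,\dots,L_n$ and the identity and is closed in the weak operator topology. -/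

import Mathlib

open Filter Topology
open scoped lp ComplexConjugate

namespace FockDomain

noncomputable section

/-! ### Words and positive regular free holomorphic functions -/

/-- The free semigroup on `n` generators: words `g_{i₁} ⋯ g_{i_k}` are lists `[i₁, …, i_k]`, the
product is concatenation `++`, the unit is `[]`, the length of a word is `List.length`. -/
abbrev Word (n : ℕ) : Type := List (Fin n)

/-- `evalWord x α = x_{i₁} ⋯ x_{i_k}` for `α = g_{i₁} ⋯ g_{i_k}`, and `1` for the empty word. -/
def evalWord {n : ℕ} {R : Type*} [Monoid R] (x : Fin n → R) (α : Word n) : R :=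
  (α.map x).prod

/-- A positive regular free holomorphic function `f = ∑ a_α X_α` on the noncommutative ball
`{(X₁, …, Xₙ) ∈ B(H)ⁿ : ‖X₁X₁* + ⋯ + XₙXₙ*‖ < ρ}` for some `ρ > 0`: the coefficients satisfy
`a_α ≥ 0`, `a_{g₀} = 0`, `a_{g_i} > 0`, and the series `∑_k ∑_{|α| = k} a_α X_α` converges in
the operator norm at each point of the ball. The words of length `k` are listed as
`List.ofFn v`, `v : Fin k → Fin n`. -/
structure PosRegFreeHol (n : ℕ) (H : Type*) [NormedAddCommGroup H] [InnerProductSpace ℂ H]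
    [CompleteSpace H] where
  /-- the coefficients `a_α` -/
  coeff : Word n → ℝ
  /-- the size of the ball -/
  ρ : ℝ
  ρ_pos : 0 < ρ
  coeff_nonneg : ∀ α, 0 ≤ coeff α
  coeff_nil : coeff [] = 0
  coeff_gen_pos : ∀ i, 0 < coeff [i]
  converges : ∀ X : Fin n → (H →L[ℂ] H),
    ‖∑ i, X i * ContinuousLinearMap.adjoint (X i)‖ < ρ →
      ∃ Y : H →L[ℂ] H, Tendsto
        (fun N : ℕ => ∑ k ∈ Finset.range N, ∑ v : Fin k → Fin n,
          (coeff (List.ofFn v) : ℂ) • evalWord X (List.ofFn v)) atTop (𝓝 Y)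

variable {n : ℕ} {H : Type*} [NormedAddCommGroup H] [InnerProductSpace ℂ H] [CompleteSpace H]

/-- The scalar domain `{λ ∈ ℂⁿ : ∑_{|α| ≥ 1} a_α |λ_α|² < 1}` (the sum may be taken over all
words since `a_{g₀} = 0`; it is required to converge). -/
def scalarDomain (f : PosRegFreeHol n H) : Set (Fin n → ℂ) :=
  {x | Summable (fun α : Word n => f.coeff α * ‖evalWord x α‖ ^ 2) ∧
    ∑' α : Word n, f.coeff α * ‖evalWord x α‖ ^ 2 < 1}

/-- The coefficients
`b_α^{(m)} = ∑_j ∑_{γ₁ ⋯ γ_j = α, |γ_i| ≥ 1} a_{γ₁} ⋯ a_{γ_j} (j + m - 1 choose m - 1)`.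
A factorization of `α` into `j` nonempty words is a composition of the number `|α|` into `j`
parts. For the empty word the only composition has no parts, and `b_{g₀}^{(m)} = 1`. -/
def bCoeff (f : PosRegFreeHol n H) (m : ℕ) (α : Word n) : ℝ :=
  ∑ c : Composition α.length,
    ((α.splitWrtComposition c).map f.coeff).prod * ((c.length + m - 1).choose (m - 1) : ℝ)

/-- The set `Λ_k` of the words in which each generator `g_i` occurs exactly `k i` times. -/
def wordsOfType (k : Fin n →₀ ℕ) : Finset (Word n) :=
  (Multiset.lists (Finsupp.toMultiset k)).toFinset

theorem mem_wordsOfType (k : Fin n →₀ ℕ) (α : Word n) :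
    α ∈ wordsOfType k ↔ ∀ i, α.count i = k i := by
  rw [wordsOfType, Multiset.mem_toFinset, Multiset.mem_lists_iff]
  change Finsupp.toMultiset k = (α : Multiset (Fin n)) ↔ _
  rw [Multiset.ext]
  simp only [Finsupp.count_toMultiset, Multiset.coe_count]
  exact forall_congr' fun _ => eq_comm

/-- `γ_k^{(m)} = ∑_{α ∈ Λ_k} b_α^{(m)}`. -/
def gammaCoeff (f : PosRegFreeHol n H) (m : ℕ) (k : Fin n →₀ ℕ) : ℝ :=
  ∑ α ∈ wordsOfType k, bCoeff f m α

/-! ### Elementary facts about the coefficients -/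

theorem prod_coeff_nonneg (f : PosRegFreeHol n H) (l : List (Word n)) :
    0 ≤ (l.map f.coeff).prod := by
  apply List.prod_nonneg
  intro x hx
  obtain ⟨α, -, rfl⟩ := List.mem_map.1 hx
  exact f.coeff_nonneg α

theorem bCoeff_nonneg (f : PosRegFreeHol n H) (m : ℕ) (α : Word n) : 0 ≤ bCoeff f m α :=
  Finset.sum_nonneg fun _ _ => mul_nonneg (prod_coeff_nonneg f _) (Nat.cast_nonneg _)

theorem bCoeff_nil (f : PosRegFreeHol n H) (m : ℕ) : bCoeff f m [] = 1 := by
  have : ∀ c : Composition ([] : Word n).length,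
      ((([] : Word n).splitWrtComposition c).map f.coeff).prod *
        ((c.length + m - 1).choose (m - 1) : ℝ) = 1 := by
    intro c
    have hl : c.blocks = [] := by
      rcases hb : c.blocks with _ | ⟨x, l⟩
      · rfl
      · have h1 := c.blocks_sum
        have h2 : 0 < x := c.blocks_pos (by simp [hb])
        rw [hb] at h1
        simp at h1
        omega
    simp [List.splitWrtComposition, List.splitWrtCompositionAux, Composition.length, hl]
  rw [bCoeff, Finset.sum_congr rfl (fun c _ => this c)]
  simp [Finset.card_univ, composition_card]

/-- `a_{g_i} b_α ≤ b_{g_i α}`. -/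
theorem coeff_mul_bCoeff_le (f : PosRegFreeHol n H) (m : ℕ) (i : Fin n) (α : Word n) :
    f.coeff [i] * bCoeff f m α ≤ bCoeff f m (i :: α) := by
  let e : Composition α.length → Composition (i :: α).length := fun c =>
    { blocks := 1 :: c.blocks
      blocks_pos := by
        intro j hj
        rcases List.mem_cons.1 hj with h | h
        · omega
        · exact c.blocks_pos h
      blocks_sum := by
        have := c.blocks_sum
        simp [this, add_comm] }
  have he : Function.Injective e := by
    intro c d h
    have : (e c).blocks = (e d).blocks := by rw [h]
    apply Composition.ext
    simpa [e] using this
  calc f.coeff [i] * bCoeff f m α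
      ≤ ∑ c : Composition α.length, (((i :: α).splitWrtComposition (e c)).map f.coeff).prod *
          (((e c).length + m - 1).choose (m - 1) : ℝ) := by
        rw [bCoeff, Finset.mul_sum]
        apply Finset.sum_le_sum
        intro c _
        have h1 : (((i :: α).splitWrtComposition (e c)).map f.coeff).prod =
            f.coeff [i] * ((α.splitWrtComposition c).map f.coeff).prod := by
          simp [List.splitWrtComposition, e, List.splitWrtCompositionAux]
        rw [h1, mul_assoc]
        have h2 : (c.length + m - 1).choose (m - 1) ≤ ((e c).length + m - 1).choose (m - 1) := by
          apply Nat.choose_le_choose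
          simp only [Composition.length, e, List.length_cons]
          omega
        have h2' : ((c.length + m - 1).choose (m - 1) : ℝ) ≤
            (((e c).length + m - 1).choose (m - 1) : ℝ) := by exact_mod_cast h2
        exact mul_le_mul_of_nonneg_left
          (mul_le_mul_of_nonneg_left h2' (prod_coeff_nonneg f _)) (f.coeff_nonneg _)
    _ = ∑ d ∈ Finset.univ.map ⟨e, he⟩, (((i :: α).splitWrtComposition d).map f.coeff).prod *
          ((d.length + m - 1).choose (m - 1) : ℝ) := by
        rw [Finset.sum_map]
        rfl
    _ ≤ bCoeff f m (i :: α) :=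
        Finset.sum_le_sum_of_subset_of_nonneg (Finset.subset_univ _)
          fun _ _ _ => mul_nonneg (prod_coeff_nonneg f _) (Nat.cast_nonneg _)

theorem bCoeff_pos (f : PosRegFreeHol n H) (m : ℕ) (α : Word n) : 0 < bCoeff f m α := by
  induction α with
  | nil => simp [bCoeff_nil]
  | cons i α ih => exact (mul_pos (f.coeff_gen_pos i) ih).trans_le (coeff_mul_bCoeff_le f m i α)

theorem gammaCoeff_pos (f : PosRegFreeHol n H) (m : ℕ) (k : Fin n →₀ ℕ) :
    0 < gammaCoeff f m k := by
  apply Finset.sum_pos (fun α _ => bCoeff_pos f m α)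
  obtain ⟨l, hl⟩ := Quot.exists_rep (Finsupp.toMultiset k)
  exact ⟨l, by
    rw [wordsOfType, Multiset.mem_toFinset, Multiset.mem_lists_iff]
    exact hl.symm⟩

/-! ### The Fock space, the weighted left creation operators, the symmetric Fock space -/

/-- The full Fock space with `n` generators, with orthonormal basis `e_α`, `α` a word. -/
abbrev Fock (n : ℕ) : Type := lp (fun _ : Word n => ℂ) 2

/-- The basis vector `e_α`. -/
def basisVec (α : Word n) : Fock n := lp.single 2 α (1 : ℂ)

/-- The coordinates of `W_i φ`: since `W_i e_α = √(b_α / b_{g_i α}) e_{g_i α}`, the coordinate at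
`g_i α` is `√(b_α / b_{g_i α}) φ_α`, and it is `0` at words that do not begin with `g_i`. -/
def creationFun (f : PosRegFreeHol n H) (m : ℕ) (i : Fin n) (φ : Word n → ℂ) : Word n → ℂ
  | [] => 0
  | j :: α => if j = i then
      ((Real.sqrt (bCoeff f m α) / Real.sqrt (bCoeff f m (i :: α)) : ℝ) : ℂ) * φ α else 0

theorem weight_sq_le (f : PosRegFreeHol n H) (m : ℕ) (i : Fin n) (α : Word n) :
    (Real.sqrt (bCoeff f m α) / Real.sqrt (bCoeff f m (i :: α))) ^ 2 ≤ (f.coeff [i])⁻¹ := by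
  rw [div_pow, Real.sq_sqrt (bCoeff_nonneg f m _), Real.sq_sqrt (bCoeff_nonneg f m _),
    div_le_iff₀ (bCoeff_pos f m _), inv_mul_eq_div, le_div_iff₀ (f.coeff_gen_pos i), mul_comm]
  exact coeff_mul_bCoeff_le f m i α

theorem creationFun_hasSum (f : PosRegFreeHol n H) (m : ℕ) (i : Fin n) (φ : Fock n) :
    Summable (fun β => ‖creationFun f m i φ β‖ ^ 2) ∧
      ∑' β, ‖creationFun f m i φ β‖ ^ 2 ≤ (f.coeff [i])⁻¹ * ‖φ‖ ^ 2 := by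
  have hφ : HasSum (fun α => ‖φ α‖ ^ 2) (‖φ‖ ^ 2) := by
    have := lp.hasSum_norm (p := 2) (by norm_num) φ
    simpa using this
  have hinj : Function.Injective (fun α : Word n => i :: α) := fun _ _ h => (List.cons.inj h).2
  have hsupp : ∀ β, β ∉ Set.range (fun α : Word n => i :: α) →
      ‖creationFun f m i φ β‖ ^ 2 = 0 := by
    intro β hβ
    rcases β with _ | ⟨j, α⟩
    · simp [creationFun]
    · have : j ≠ i := by
        rintro rfl
        exact hβ ⟨α, rfl⟩
      simp [creationFun, this]
  have hle : ∀ α, ‖creationFun f m i φ (i :: α)‖ ^ 2 ≤ (f.coeff [i])⁻¹ * ‖φ α‖ ^ 2 := by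
    intro α
    have : ‖creationFun f m i φ (i :: α)‖ ^ 2 =
        (Real.sqrt (bCoeff f m α) / Real.sqrt (bCoeff f m (i :: α))) ^ 2 * ‖φ α‖ ^ 2 := by
      simp only [creationFun, if_true, norm_mul, mul_pow, Complex.norm_real, Real.norm_eq_abs,
        sq_abs]
    rw [this]
    exact mul_le_mul_of_nonneg_right (weight_sq_le f m i α) (sq_nonneg _)
  have hs : Summable (fun α => ‖creationFun f m i φ (i :: α)‖ ^ 2) :=
    Summable.of_nonneg_of_le (fun _ => sq_nonneg _) hle (hφ.mul_left _).summable
  have hs' := (hinj.hasSum_iff hsupp).1 hs.hasSum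
  refine ⟨hs'.summable, ?_⟩
  rw [hs'.tsum_eq, ← (hφ.mul_left (f.coeff [i])⁻¹).tsum_eq]
  exact hs.tsum_le_tsum hle (hφ.mul_left _).summable

/-- The weighted left creation operator `W_i` on the full Fock space, as a linear map. -/
def creationLin (f : PosRegFreeHol n H) (m : ℕ) (i : Fin n) : Fock n →ₗ[ℂ] Fock n where
  toFun φ := ⟨creationFun f m i φ, memℓp_gen (by
    simpa using (creationFun_hasSum f m i φ).1)⟩
  map_add' φ ψ := by
    ext β
    change creationFun f m i (fun α => φ α + ψ α) β =
      creationFun f m i φ β + creationFun f m i ψ β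
    rcases β with _ | ⟨j, α⟩
    · simp [creationFun]
    · by_cases h : j = i <;> simp [creationFun, h, mul_add]
  map_smul' c φ := by
    ext β
    rcases β with _ | ⟨j, α⟩
    · simp [creationFun]
    · by_cases h : j = i <;> simp [creationFun, h, mul_left_comm]

/-- The weighted left creation operator `W_i`, a bounded operator on the full Fock space. -/
def creation (f : PosRegFreeHol n H) (m : ℕ) (i : Fin n) : Fock n →L[ℂ] Fock n :=
  (creationLin f m i).mkContinuous (Real.sqrt (f.coeff [i])⁻¹) (by
    intro φ
    have h1 := lp.hasSum_norm (p := 2) (by norm_num) (creationLin f m i φ)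
    have h2 : HasSum (fun β => ‖creationFun f m i φ β‖ ^ 2) (‖creationLin f m i φ‖ ^ 2) := by
      simpa [creationLin] using h1
    have h3 : ‖creationLin f m i φ‖ ^ 2 ≤ (f.coeff [i])⁻¹ * ‖φ‖ ^ 2 := by
      rw [← h2.tsum_eq]
      exact (creationFun_hasSum f m i φ).2
    have h4 : (0 : ℝ) ≤ (f.coeff [i])⁻¹ := inv_nonneg.2 (f.coeff_nonneg _)
    apply le_of_sq_le_sq _ (by positivity)
    rw [mul_pow, Real.sq_sqrt h4]
    exact h3)

/-- `W_i e_α = (√b_α / √b_{g_i α}) e_{g_i α}`. -/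
theorem creation_basisVec (f : PosRegFreeHol n H) (m : ℕ) (i : Fin n) (α : Word n) :
    creation f m i (basisVec α) =
      ((Real.sqrt (bCoeff f m α) / Real.sqrt (bCoeff f m (i :: α)) : ℝ) : ℂ) •
        basisVec (i :: α) := by
  ext β
  have : creation f m i (basisVec α) β = creationFun f m i (basisVec α) β := rfl
  rw [this]
  rcases β with _ | ⟨j, β⟩
  · simp [creationFun, basisVec, lp.single_apply]
  · by_cases h : j = i
    · subst h
      by_cases h' : β = α
      · subst h'
        simp [creationFun, basisVec]
      · simp [creationFun, basisVec, lp.single_apply, h']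
    · simp [creationFun, basisVec, lp.single_apply, h]

/-- The vector `w^k = (1 / γ_k) ∑_{α ∈ Λ_k} √b_α e_α`. -/
def symVec (f : PosRegFreeHol n H) (m : ℕ) (k : Fin n →₀ ℕ) : Fock n :=
  ((gammaCoeff f m k)⁻¹ : ℂ) •
    ∑ α ∈ wordsOfType k, (Real.sqrt (bCoeff f m α) : ℂ) • basisVec α

/-- The symmetric weighted Fock space: the closed span of the vectors `w^k`. -/
def symFock (f : PosRegFreeHol n H) (m : ℕ) : Submodule ℂ (Fock n) :=
  (Submodule.span ℂ (Set.range (symVec f m))).topologicalClosure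

instance (f : PosRegFreeHol n H) (m : ℕ) : CompleteSpace (symFock f m) :=
  inferInstanceAs (CompleteSpace (Submodule.span ℂ (Set.range (symVec f m))).topologicalClosure)

/-- The operator `L_i`: the compression of `W_i` to the symmetric weighted Fock space. -/
def symShift (f : PosRegFreeHol n H) (m : ℕ) (i : Fin n) : symFock f m →L[ℂ] symFock f m :=
  (symFock f m).orthogonalProjectionOnto ∘L creation f m i ∘L (symFock f m).subtypeL

/-! ### The scalar domain contains a polydisc; uniqueness of power series on it -/

theorem evalWord_norm_sq_le {x : Fin n → ℂ} {q : ℝ} (hx : ∀ i, ‖x i‖ ^ 2 ≤ q)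
    (α : Word n) : ‖evalWord x α‖ ^ 2 ≤ q ^ α.length := by
  induction α with
  | nil => simp [evalWord]
  | cons i α ih =>
    have : evalWord x (i :: α) = x i * evalWord x α := by simp [evalWord]
    rw [this, norm_mul, mul_pow, List.length_cons, pow_succ' q]
    exact mul_le_mul (hx i) ih (sq_nonneg _) ((sq_nonneg _).trans (hx i))

theorem exists_summable [Nontrivial H] (f : PosRegFreeHol n H) :
    ∃ t : ℝ, 0 < t ∧ Summable (fun k : ℕ => (∑ v : Fin k → Fin n, f.coeff (List.ofFn v)) * t ^ k)
    := by
  obtain ⟨t, ht, htρ⟩ : ∃ t : ℝ, 0 < t ∧ (n : ℝ) * t ^ 2 < f.ρ := by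
    have hc : Tendsto (fun t : ℝ => (n : ℝ) * t ^ 2) (𝓝[>] 0) (𝓝 0) := by
      have : Continuous (fun t : ℝ => (n : ℝ) * t ^ 2) := by fun_prop
      simpa using (this.tendsto 0).mono_left nhdsWithin_le_nhds
    obtain ⟨t, h1, h2⟩ := ((hc.eventually_lt_const f.ρ_pos).and self_mem_nhdsWithin).exists
    exact ⟨t, h2, h1⟩
  refine ⟨t, ht, ?_⟩
  have hA : ∀ k : ℕ, 0 ≤ (∑ v : Fin k → Fin n, f.coeff (List.ofFn v)) * t ^ k := fun k =>
    mul_nonneg (Finset.sum_nonneg fun _ _ => f.coeff_nonneg _) (pow_nonneg ht.le _)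
  obtain ⟨Y, hY⟩ := f.converges (fun _ => (t : ℂ) • (1 : H →L[ℂ] H)) (by
    have h1 : ∀ i : Fin n, ((t : ℂ) • (1 : H →L[ℂ] H)) *
        ContinuousLinearMap.adjoint ((t : ℂ) • (1 : H →L[ℂ] H)) =
        ((t ^ 2 : ℝ) : ℂ) • (1 : H →L[ℂ] H) := by
      intro i
      have : ContinuousLinearMap.adjoint ((t : ℂ) • (1 : H →L[ℂ] H)) =
          (t : ℂ) • (1 : H →L[ℂ] H) := by
        rw [← ContinuousLinearMap.star_eq_adjoint, star_smul, star_one]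
        simp
      rw [this, smul_mul_smul_comm, mul_one]
      congr 1
      push_cast
      ring
    rw [Finset.sum_congr rfl (fun i _ => h1 i), Finset.sum_const, Finset.card_univ,
      Fintype.card_fin, ← Nat.cast_smul_eq_nsmul ℂ, smul_smul, norm_smul, norm_one, mul_one,
      norm_mul, Complex.norm_real, Real.norm_eq_abs, abs_of_nonneg (sq_nonneg t)]
    simpa using htρ)
  have hterm : ∀ N : ℕ, (∑ k ∈ Finset.range N, ∑ v : Fin k → Fin n,
      (f.coeff (List.ofFn v) : ℂ) • evalWord (fun _ => (t : ℂ) • (1 : H →L[ℂ] H))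
        (List.ofFn v)) =
      ((∑ k ∈ Finset.range N, (∑ v : Fin k → Fin n, f.coeff (List.ofFn v)) * t ^ k : ℝ) : ℂ) •
        (1 : H →L[ℂ] H) := by
    intro N
    rw [Complex.ofReal_sum, Finset.sum_smul]
    apply Finset.sum_congr rfl
    intro k _
    rw [Complex.ofReal_mul, Complex.ofReal_sum, Finset.sum_mul, Finset.sum_smul]
    apply Finset.sum_congr rfl
    intro v _
    have : evalWord (fun _ => (t : ℂ) • (1 : H →L[ℂ] H)) (List.ofFn v) =
        ((t : ℂ) ^ k) • (1 : H →L[ℂ] H) := by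
      have hr : (List.ofFn v).map (fun _ => (t : ℂ) • (1 : H →L[ℂ] H)) =
          List.replicate k ((t : ℂ) • (1 : H →L[ℂ] H)) := by
        rw [List.map_const', List.length_ofFn]
      rw [evalWord, hr, List.prod_replicate, smul_pow, one_pow]
    rw [this, smul_smul]
    push_cast
    rfl
  have hnorm := hY.norm
  simp only [hterm, norm_smul, norm_one, mul_one, Complex.norm_real, Real.norm_eq_abs] at hnorm
  obtain ⟨C, hC⟩ := hnorm.bddAbove_range
  exact summable_of_sum_range_le (c := C) hA fun N =>
    (le_abs_self _).trans (hC ⟨N, rfl⟩)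

theorem exists_polydisc [Nontrivial H] (f : PosRegFreeHol n H) :
    ∃ r : ℝ, 0 < r ∧ ∀ x : Fin n → ℂ, (∀ i, ‖x i‖ ≤ r) → x ∈ scalarDomain f := by
  obtain ⟨t, ht, hs⟩ := exists_summable f
  set A : ℕ → ℝ := fun k => ∑ v : Fin k → Fin n, f.coeff (List.ofFn v) with hAdef
  have hA : ∀ k, 0 ≤ A k := fun k => Finset.sum_nonneg fun _ _ => f.coeff_nonneg _
  have hA0 : A 0 = 0 := by simp [hAdef, f.coeff_nil]
  set C : ℝ := ∑' k, A k * t ^ k with hC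
  have hC0 : 0 ≤ C := tsum_nonneg fun k => mul_nonneg (hA k) (pow_nonneg ht.le _)
  set u : ℝ := 1 / (C + 2) with hu
  have hu0 : 0 < u := by positivity
  have hu1 : u ≤ 1 := by
    rw [hu, div_le_one (by linarith)]
    linarith
  have huC : u * C < 1 := by
    rw [hu, one_div, inv_mul_eq_div, div_lt_one (by linarith)]
    linarith
  have hle : ∀ k, A k * (u * t) ^ k ≤ u * (A k * t ^ k) := by
    intro k
    rcases k with _ | k
    · simp [hA0]
    · have h1 : u ^ (k + 1) ≤ u := by
        rw [pow_succ]
        exact mul_le_of_le_one_left hu0.le (pow_le_one₀ hu0.le hu1)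
      have h2 : 0 ≤ A (k + 1) * t ^ (k + 1) := mul_nonneg (hA _) (pow_nonneg ht.le _)
      rw [mul_pow]
      nlinarith
  have hs' : Summable (fun k => A k * (u * t) ^ k) :=
    Summable.of_nonneg_of_le (fun k => mul_nonneg (hA k) (by positivity)) hle (hs.mul_left u)
  have hlt : ∑' k, A k * (u * t) ^ k < 1 := by
    calc ∑' k, A k * (u * t) ^ k ≤ ∑' k, u * (A k * t ^ k) := hs'.tsum_le_tsum hle (hs.mul_left u)
      _ = u * C := by rw [tsum_mul_left]
      _ < 1 := huC
  refine ⟨Real.sqrt (u * t), Real.sqrt_pos.2 (by positivity), fun x hx => ?_⟩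
  have hx' : ∀ i, ‖x i‖ ^ 2 ≤ u * t := fun i => by
    have := pow_le_pow_left₀ (norm_nonneg _) (hx i) 2
    rwa [Real.sq_sqrt (by positivity)] at this
  have hbound : ∀ α : Word n,
      f.coeff α * ‖evalWord x α‖ ^ 2 ≤ f.coeff α * (u * t) ^ α.length := fun α =>
    mul_le_mul_of_nonneg_left (evalWord_norm_sq_le hx' α) (f.coeff_nonneg α)
  have hsig : HasSum (fun p : Σ k, Fin k → Fin n => f.coeff (List.ofFn p.2) * (u * t) ^ p.1)
      (∑' k, A k * (u * t) ^ k) := by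
    have hsum : Summable (fun p : Σ k, Fin k → Fin n =>
        f.coeff (List.ofFn p.2) * (u * t) ^ p.1) := by
      rw [summable_sigma_of_nonneg
        (fun p => mul_nonneg (f.coeff_nonneg _) (pow_nonneg (by positivity) _))]
      refine ⟨fun k => (hasSum_fintype _).summable, ?_⟩
      simpa only [tsum_fintype, ← Finset.sum_mul] using hs'
    have := hsum.hasSum
    rw [hsum.tsum_sigma] at this
    simpa only [tsum_fintype, ← Finset.sum_mul] using this
  have hword : HasSum (fun α : Word n => f.coeff α * (u * t) ^ α.length)
      (∑' k, A k * (u * t) ^ k) := by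
    rw [← (List.equivSigmaTuple (α := Fin n)).symm.hasSum_iff]
    convert hsig using 2 with p
    simp [List.equivSigmaTuple]
  have hsx : Summable (fun α : Word n => f.coeff α * ‖evalWord x α‖ ^ 2) :=
    Summable.of_nonneg_of_le (fun α => mul_nonneg (f.coeff_nonneg α) (sq_nonneg _)) hbound
      hword.summable
  refine ⟨hsx, ?_⟩
  calc _ ≤ _ := hsx.tsum_le_tsum hbound hword.summable
    _ = _ := hword.tsum_eq
    _ < 1 := hlt

/-- The monomial `λ^k = λ₁^{k₁} ⋯ λₙ^{kₙ}`. -/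
def monomialAt (x : Fin n → ℂ) (k : Fin n →₀ ℕ) : ℂ := ∏ i, x i ^ k i

theorem hasSum_by_degree (F : (Fin n →₀ ℕ) → ℂ) {a : ℂ} (h : HasSum F a) :
    HasSum (fun N => ∑ k ∈ Finset.univ.finsuppAntidiag N, F k) a := by
  let d : (Fin n →₀ ℕ) → ℕ := fun k => ∑ i, k i
  have h2 : HasSum (F ∘ Equiv.sigmaFiberEquiv d) a := (Equiv.sigmaFiberEquiv d).hasSum_iff.2 h
  refine h2.sigma fun N => ?_
  have e : ∀ k : Fin n →₀ ℕ, d k = N ↔ k ∈ Finset.univ.finsuppAntidiag N :=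
    fun k => by simp [d, Finset.mem_finsuppAntidiag]
  exact (Equiv.subtypeEquivRight e).hasSum_iff.2
    (Finset.hasSum (Finset.univ.finsuppAntidiag N) F)

theorem powerSeries_unique [Nontrivial H] (f : PosRegFreeHol n H) (c : (Fin n →₀ ℕ) → ℂ)
    (h : ∀ x ∈ scalarDomain f, HasSum (fun k => c k * monomialAt x k) 0) : c = 0 := by
  obtain ⟨r, hr, hD⟩ := exists_polydisc f
  have key : ∀ (N : ℕ) (x : Fin n → ℂ), (∀ i, ‖x i‖ ≤ r) →
      ∑ k ∈ Finset.univ.finsuppAntidiag N, c k * monomialAt x k = 0 := by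
    intro N x hx
    set P : ℕ → ℂ := fun N => ∑ k ∈ Finset.univ.finsuppAntidiag N, c k * monomialAt x k with hP
    have hs : ∀ s : ℂ, ‖s‖ ≤ 1 → HasSum (fun N => s ^ N * P N) 0 := by
      intro s hs
      have h1 := h (fun i => s * x i) (hD _ fun i => by
        rw [norm_mul]
        exact (mul_le_of_le_one_left (norm_nonneg _) hs).trans (hx i))
      convert hasSum_by_degree _ h1 using 2 with N
      rw [hP, Finset.mul_sum]
      apply Finset.sum_congr rfl
      intro k hk
      have hk' : ∑ i, k i = N := (Finset.mem_finsuppAntidiag.1 hk).1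
      simp only [monomialAt, mul_pow, Finset.prod_mul_distrib, Finset.prod_pow_eq_pow_sum, hk']
      ring
    have hps : HasFPowerSeriesAt (0 : ℂ → ℂ) (FormalMultilinearSeries.ofScalars ℂ P) 0 := by
      rw [hasFPowerSeriesAt_iff]
      filter_upwards [Metric.closedBall_mem_nhds (0 : ℂ) one_pos] with s hs'
      have := hs s (by simpa using hs')
      simpa [FormalMultilinearSeries.coeff_ofScalars] using this
    have := congrArg (fun p => FormalMultilinearSeries.coeff p N) hps.eq_zero
    simp only [FormalMultilinearSeries.coeff_ofScalars] at this
    exact this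
  funext k
  set N := ∑ i, k i with hN
  let Q : MvPolynomial (Fin n) ℂ :=
    ∑ k ∈ Finset.univ.finsuppAntidiag N, MvPolynomial.monomial k (c k)
  have hQ : Q = 0 := by
    apply MvPolynomial.funext_set (fun _ => Metric.closedBall (0 : ℂ) r)
    · intro i
      exact (infinite_of_mem_nhds (0 : ℂ) (Metric.closedBall_mem_nhds 0 hr))
    · intro x hx
      have := key N x fun i => by simpa using hx i (Set.mem_univ i)
      rw [map_zero, map_sum]
      simpa [MvPolynomial.eval_monomial, monomialAt, Finsupp.prod_fintype] using this
  have hcoeff := congrArg (MvPolynomial.coeff k) hQ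
  simp only [Q, MvPolynomial.coeff_sum, MvPolynomial.coeff_monomial, MvPolynomial.coeff_zero,
    Finset.sum_ite_eq'] at hcoeff
  rw [if_pos (by simp [Finset.mem_finsuppAntidiag, hN])] at hcoeff
  exact hcoeff

/-! ### The Hilbert space of functions on the scalar domain -/

/-- `c` are the coefficients of a power series representation
`φ(λ) = ∑_k c_k λ^k` on the scalar domain with `∑_k |c_k|² / γ_k < ∞`. -/
structure IsPowerSeriesRep (f : PosRegFreeHol n H) (m : ℕ) (φ : scalarDomain f → ℂ)
    (c : (Fin n →₀ ℕ) → ℂ) : Prop where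
  summable : Summable (fun k => ‖c k‖ ^ 2 / gammaCoeff f m k)
  hasSum : ∀ x : scalarDomain f, HasSum (fun k => c k * monomialAt (x : Fin n → ℂ) k) (φ x)

theorem memℓp_iff_summable (f : PosRegFreeHol n H) (m : ℕ) (c : (Fin n →₀ ℕ) → ℂ) :
    Memℓp (fun k => c k / (Real.sqrt (gammaCoeff f m k) : ℂ)) 2 ↔
      Summable (fun k => ‖c k‖ ^ 2 / gammaCoeff f m k) := by
  rw [memℓp_gen_iff (by norm_num)]
  apply iff_of_eq
  congr 1
  funext k
  simp [div_pow, Real.sq_sqrt (gammaCoeff_pos f m k).le]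

theorem IsPowerSeriesRep.add {f : PosRegFreeHol n H} {m : ℕ} {φ ψ : scalarDomain f → ℂ}
    {c d : (Fin n →₀ ℕ) → ℂ} (hc : IsPowerSeriesRep f m φ c) (hd : IsPowerSeriesRep f m ψ d) :
    IsPowerSeriesRep f m (φ + ψ) (c + d) where
  summable := by
    rw [← memℓp_iff_summable]
    have := ((memℓp_iff_summable f m c).2 hc.summable).add
      ((memℓp_iff_summable f m d).2 hd.summable)
    convert this using 1
    funext k
    simp [add_div]
  hasSum x := by
    simpa [add_mul] using (hc.hasSum x).add (hd.hasSum x)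

theorem IsPowerSeriesRep.smul {f : PosRegFreeHol n H} {m : ℕ} {φ : scalarDomain f → ℂ}
    {c : (Fin n →₀ ℕ) → ℂ} (a : ℂ) (hc : IsPowerSeriesRep f m φ c) :
    IsPowerSeriesRep f m (a • φ) (a • c) where
  summable := by
    simpa [mul_pow, mul_div_assoc] using hc.summable.mul_left (‖a‖ ^ 2)
  hasSum x := by
    simpa [mul_assoc] using (hc.hasSum x).mul_left a

theorem IsPowerSeriesRep.unique [Nontrivial H] {f : PosRegFreeHol n H} {m : ℕ}
    {φ : scalarDomain f → ℂ} {c d : (Fin n →₀ ℕ) → ℂ} (hc : IsPowerSeriesRep f m φ c)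
    (hd : IsPowerSeriesRep f m φ d) : c = d := by
  rw [← sub_eq_zero]
  apply powerSeries_unique f
  intro x hx
  simpa [sub_mul] using (hc.hasSum ⟨x, hx⟩).sub (hd.hasSum ⟨x, hx⟩)

/-- The functions on the scalar domain that admit such a power series representation. -/
def hardySubmodule (f : PosRegFreeHol n H) (m : ℕ) : Submodule ℂ (scalarDomain f → ℂ) where
  carrier := {φ | ∃ c, IsPowerSeriesRep f m φ c}
  add_mem' := fun ⟨_, hc⟩ ⟨_, hd⟩ => ⟨_, hc.add hd⟩
  zero_mem' := ⟨0, ⟨by simp, fun x => by simp⟩⟩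
  smul_mem' := fun a _ ⟨_, hc⟩ => ⟨_, hc.smul a⟩

/-- The space `H²` of the functions on the scalar domain that admit a power series representation
`φ(λ) = ∑_k c_k λ^k` with `∑_k |c_k|² / γ_k < ∞`. It is a type of its own, so that it carries the
Hilbert space norm and not the topology of pointwise convergence. -/
def HardySpace (f : PosRegFreeHol n H) (m : ℕ) : Type :=
  ↥(hardySubmodule f m)

namespace HardySpace

variable {f : PosRegFreeHol n H} {m : ℕ}

instance : CoeFun (HardySpace f m) (fun _ => scalarDomain f → ℂ) := ⟨Subtype.val⟩

instance instAddCommGroup : AddCommGroup (HardySpace f m) :=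
  inferInstanceAs (AddCommGroup ↥(hardySubmodule f m))

instance instModule : Module ℂ (HardySpace f m) :=
  inferInstanceAs (Module ℂ ↥(hardySubmodule f m))

theorem ext {φ ψ : HardySpace f m} (h : ∀ x, φ x = ψ x) : φ = ψ := Subtype.ext (funext h)

theorem add_apply (φ ψ : HardySpace f m) (x : scalarDomain f) : (φ + ψ) x = φ x + ψ x := rfl

theorem smul_apply (a : ℂ) (φ : HardySpace f m) (x : scalarDomain f) : (a • φ) x = a * φ x := rfl

/-- The power series coefficients `c_k` of an element of `H²` (they are unique). -/
def coef (φ : HardySpace f m) : (Fin n →₀ ℕ) → ℂ := φ.2.choose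

theorem coef_spec (φ : HardySpace f m) : IsPowerSeriesRep f m φ (coef φ) := φ.2.choose_spec

/-- The injective linear map `φ ↦ (c_k / √γ_k)_k` of `H²` into `ℓ²`. -/
def coefMap [Nontrivial H] (f : PosRegFreeHol n H) (m : ℕ) :
    HardySpace f m →ₗ[ℂ] lp (fun _ : Fin n →₀ ℕ => ℂ) 2 where
  toFun φ := ⟨fun k => coef φ k / (Real.sqrt (gammaCoeff f m k) : ℂ),
    (memℓp_iff_summable f m _).2 (coef_spec φ).summable⟩
  map_add' φ ψ := by
    have h : coef (φ + ψ) = coef φ + coef ψ :=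
      (coef_spec (φ + ψ)).unique ((coef_spec φ).add (coef_spec ψ))
    ext k
    change coef (φ + ψ) k / (Real.sqrt (gammaCoeff f m k) : ℂ) =
      coef φ k / (Real.sqrt (gammaCoeff f m k) : ℂ) +
        coef ψ k / (Real.sqrt (gammaCoeff f m k) : ℂ)
    rw [h, Pi.add_apply, add_div]
  map_smul' a φ := by
    have h : coef (a • φ) = a • coef φ := (coef_spec (a • φ)).unique ((coef_spec φ).smul a)
    ext k
    simp [h, mul_div_assoc]

theorem coefMap_injective [Nontrivial H] : Function.Injective (coefMap f m) := by
  intro φ ψ h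
  have hc : coef φ = coef ψ := by
    funext k
    have hk : coef φ k / (Real.sqrt (gammaCoeff f m k) : ℂ) =
        coef ψ k / (Real.sqrt (gammaCoeff f m k) : ℂ) :=
      congrFun (congrArg (fun z : lp (fun _ : Fin n →₀ ℕ => ℂ) 2 =>
        (z : (Fin n →₀ ℕ) → ℂ)) h) k
    have hpos : (Real.sqrt (gammaCoeff f m k) : ℂ) ≠ 0 := by
      exact_mod_cast (Real.sqrt_pos.2 (gammaCoeff_pos f m k)).ne'
    field_simp at hk
    exact hk
  apply ext
  intro x
  have h1 := (coef_spec φ).hasSum x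
  rw [hc] at h1
  exact h1.unique ((coef_spec ψ).hasSum x)

/-- The norm on `H²` is given by `‖φ‖² = ∑_k |c_k|² / γ_k`, see `norm_sq_eq`. -/
instance instNormedAddCommGroup [Nontrivial H] : NormedAddCommGroup (HardySpace f m) :=
  NormedAddCommGroup.induced _ _ (coefMap f m) coefMap_injective

instance instInnerProductSpace [Nontrivial H] : InnerProductSpace ℂ (HardySpace f m) where
  norm_smul_le a φ := by
    change ‖coefMap f m (a • φ)‖ ≤ ‖a‖ * ‖coefMap f m φ‖
    rw [map_smul, norm_smul]
  inner φ ψ := inner ℂ (coefMap f m φ) (coefMap f m ψ)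
  norm_sq_eq_re_inner φ := norm_sq_eq_re_inner (𝕜 := ℂ) (coefMap f m φ)
  conj_inner_symm φ ψ := inner_conj_symm (coefMap f m φ) (coefMap f m ψ)
  add_left φ ψ χ := by
    rw [map_add, inner_add_left]
  smul_left φ ψ a := by
    rw [map_smul, inner_smul_left]

theorem norm_sq_eq [Nontrivial H] (φ : HardySpace f m) :
    ‖φ‖ ^ 2 = ∑' k, ‖coef φ k‖ ^ 2 / gammaCoeff f m k := by
  have h1 := (lp.hasSum_norm (p := 2) (by norm_num) (coefMap f m φ)).tsum_eq
  have h2 : ‖φ‖ = ‖coefMap f m φ‖ := rfl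
  rw [h2]
  have h3 : ∀ k, ‖coefMap f m φ k‖ ^ (2 : ENNReal).toReal =
      ‖coef φ k‖ ^ 2 / gammaCoeff f m k := by
    intro k
    have : coefMap f m φ k = coef φ k / (Real.sqrt (gammaCoeff f m k) : ℂ) := rfl
    rw [this]
    simp [div_pow, Real.sq_sqrt (gammaCoeff_pos f m k).le]
  simp only [h3] at h1
  rw [h1]
  simp

end HardySpace

/-- The algebra `H^∞` of all multipliers of `H²`, as an algebra of operators on `H²`: the bounded
operators of multiplication by some function on the scalar domain. -/
def multiplierAlgebra [Nontrivial H] (f : PosRegFreeHol n H) (m : ℕ) :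
    Subalgebra ℂ (HardySpace f m →L[ℂ] HardySpace f m) where
  carrier := {T | ∃ g : scalarDomain f → ℂ, ∀ (ψ : HardySpace f m) (x : scalarDomain f),
    T ψ x = g x * ψ x}
  mul_mem' := by
    rintro S T ⟨g, hg⟩ ⟨h, hh⟩
    refine ⟨fun x => g x * h x, fun ψ x => ?_⟩
    have : (S * T) ψ = S (T ψ) := rfl
    rw [this, hg, hh, mul_assoc]
  add_mem' := by
    rintro S T ⟨g, hg⟩ ⟨h, hh⟩
    refine ⟨fun x => g x + h x, fun ψ x => ?_⟩
    have : (S + T) ψ x = S ψ x + T ψ x := rfl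
    rw [this, hg, hh, add_mul]
  algebraMap_mem' := by
    intro a
    exact ⟨fun _ => a, fun ψ x => rfl⟩

/-! ### Reflexive operator algebras and WOT-closed algebras -/

section Operators

variable {E : Type*} [NormedAddCommGroup E] [InnerProductSpace ℂ E]

/-- `Lat 𝓤`: the closed subspaces that are invariant under each operator in `𝓤`. -/
def Lat (U : Set (E →L[ℂ] E)) : Set (Submodule ℂ E) :=
  {M | IsClosed (M : Set E) ∧ ∀ A ∈ U, ∀ x ∈ M, A x ∈ M}

/-- `Alg 𝓢`: the bounded operators that leave each subspace in `𝓢` invariant. -/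
def Alg (S : Set (Submodule ℂ E)) : Set (E →L[ℂ] E) :=
  {A | ∀ M ∈ S, ∀ x ∈ M, A x ∈ M}

/-- An algebra `𝓤` of operators is reflexive if `𝓤 = Alg Lat 𝓤`. -/
def IsReflexive (U : Subalgebra ℂ (E →L[ℂ] E)) : Prop :=
  (U : Set (E →L[ℂ] E)) = Alg (Lat (U : Set (E →L[ℂ] E)))

/-- The weakly closed algebra generated by `S` and the identity: the smallest unital algebra of
operators that contains `S` and is closed in the weak operator topology. -/
def wotClosedAlgebra (S : Set (E →L[ℂ] E)) : Subalgebra ℂ (E →L[ℂ] E) :=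
  sInf {A | S ⊆ A ∧
    IsClosed ((ContinuousLinearMapWOT.ofCLM : (E →L[ℂ] E) → (E →WOT[ℂ] E)) '' (A : Set _))}

end Operators

end

end FockDomain

open FockDomain

/-!
The vectors `√γ_k w^k` form an orthonormal basis of the symmetric weighted Fock space and the
functions `√γ_k λ^k` one of `H²`, so that matching them gives a unitary operator `U`. Since the
vector `z_λ = ∑_α √b_α conj(λ_α) e_α` is symmetric and `(Uφ)(λ) = ⟨φ, z_λ⟩`, the eigenvector
equation `W_i* z_λ = conj(λ_i) z_λ` turns `L_i` into the multiplication by `λ_i`.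

An operator that leaves invariant the orthogonal complement of each reproducing kernel, that is,
the space of the functions vanishing at a given point, is a multiplier. This gives reflexivity, and
a reflexive algebra is closed in the weak operator topology. Conversely, the Fejér means of the
symbol of a multiplier `T` are symbols of polynomials in the `L_i`. In the monomial basis passing
to a Fejér mean multiplies the matrix entries of `T` by `(1 - |d - e| / N)₊`, where `d` and `e` are
the degrees of the two monomials. These weights are inner products of vectors of norm at most one,
so by Schur the means have norm at most `‖T‖`, and they converge to `T` in the weak operator
topology because their matrix entries converge.
-/

namespace FockDomain

noncomputable section

/-! ### The weak operator topology -/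

section WeakOperatorTopology

variable {E : Type*} [NormedAddCommGroup E] [InnerProductSpace ℂ E]

theorem isClosed_ofCLM_image_Alg [CompleteSpace E] {S : Set (Submodule ℂ E)}
    (hS : ∀ M ∈ S, IsClosed (M : Set E)) :
    IsClosed ((ContinuousLinearMapWOT.ofCLM : (E →L[ℂ] E) → (E →WOT[ℂ] E)) '' Alg S) := by
  have hinter : (ContinuousLinearMapWOT.ofCLM : (E →L[ℂ] E) → (E →WOT[ℂ] E)) '' Alg S =
      ⋂ M ∈ S, ⋂ u ∈ M, ⋂ v ∈ Mᗮ, {A : E →WOT[ℂ] E | inner ℂ v (A u) = 0} := by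
    rw [Set.image_eq_preimage_of_inverse (g := ContinuousLinearMapWOT.toCLM)
      (fun _ => rfl) fun _ => rfl]
    ext A
    simp only [Set.mem_preimage, Alg, Set.mem_ofPred_eq, Set.mem_iInter]
    refine forall₂_congr fun M hM => forall₂_congr fun u _ => ?_
    have : CompleteSpace M := (hS M hM).completeSpace_coe
    rw [← Submodule.mem_orthogonal, M.orthogonal_orthogonal]
    rfl
  rw [hinter]
  refine isClosed_biInter fun M _ => isClosed_biInter fun u _ => isClosed_biInter fun v _ => ?_
  exact isClosed_eq (ContinuousLinearMapWOT.continuous_dual_apply u (innerSL ℂ v))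
    continuous_const

theorem IsReflexive.isClosed_wot [CompleteSpace E] {A : Subalgebra ℂ (E →L[ℂ] E)}
    (hA : IsReflexive A) :
    IsClosed ((ContinuousLinearMapWOT.ofCLM : (E →L[ℂ] E) → (E →WOT[ℂ] E)) '' (A : Set _)) := by
  rw [hA]
  exact isClosed_ofCLM_image_Alg fun _ hM => hM.1

theorem mem_wotClosedAlgebra_of_tendsto {α : Type*} {l : Filter α} [l.NeBot]
    {S : α → E →L[ℂ] E} {T : E →L[ℂ] E} {s : Set (E →L[ℂ] E)}
    (hS : ∀ a, S a ∈ Algebra.adjoin ℂ s)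
    (hlim : Tendsto (fun a => (ContinuousLinearMapWOT.ofCLM (S a) : E →WOT[ℂ] E)) l
      (𝓝 (ContinuousLinearMapWOT.ofCLM T))) :
    T ∈ wotClosedAlgebra s := by
  refine Algebra.mem_sInf.2 fun A hA => ?_
  obtain ⟨T', hT', hTT'⟩ := hA.2.mem_of_tendsto hlim <| Eventually.of_forall fun a =>
    Set.mem_image_of_mem _ (Algebra.adjoin_le hA.1 (hS a))
  rwa [← ContinuousLinearMapWOT.ofCLM_injective hTT']

theorem wotClosedAlgebra_le_of_isReflexive [CompleteSpace E] {s : Set (E →L[ℂ] E)}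
    {A : Subalgebra ℂ (E →L[ℂ] E)} (hs : s ⊆ A) (hA : IsReflexive A) : wotClosedAlgebra s ≤ A :=
  sInf_le ⟨hs, hA.isClosed_wot⟩

end WeakOperatorTopology

section Convergence

variable {α 𝕜 E F : Type*} {l : Filter α} [NontriviallyNormedField 𝕜]
  [NormedAddCommGroup E] [NormedSpace 𝕜 E] [NormedAddCommGroup F] [NormedSpace 𝕜 F]

theorem tendsto_clm_apply_of_dense_span {S : α → E →L[𝕜] F} {T : E →L[𝕜] F} {C : ℝ}
    (hC : ∀ a, ‖S a‖ ≤ C) {s : Set E} (hs : Dense (Submodule.span 𝕜 s : Set E))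
    (h : ∀ u ∈ s, Tendsto (fun a => S a u) l (𝓝 (T u))) (u : E) :
    Tendsto (fun a => S a u) l (𝓝 (T u)) := by
  have hequi : Equicontinuous ((↑) ∘ S) :=
    ((NormedSpace.equicontinuous_TFAE S).out 5 1 : (∃ C, ∀ a, ‖S a‖ ≤ C) ↔ _).1 ⟨C, hC⟩
  have hclosed : IsClosed {u | Tendsto (fun a => S a u) l (𝓝 (T u))} :=
    hequi.isClosed_setOfPred_tendsto T.continuous
  refine hclosed.closure_subset_iff.2 (fun v hv => ?_) (hs u)
  rw [Set.mem_ofPred_eq]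
  induction hv using Submodule.span_induction with
  | mem v hv => exact h v hv
  | zero => simpa only [map_zero] using tendsto_const_nhds
  | add v w _ _ hv hw => simpa only [map_add] using hv.add hw
  | smul c v _ hv => simpa only [map_smul] using hv.const_smul c

end Convergence

section MatrixCoefficients

variable {ι 𝕜 E : Type*} [RCLike 𝕜] [NormedAddCommGroup E] [InnerProductSpace 𝕜 E]

theorem tendsto_wot_of_tendsto_inner_basis [CompleteSpace E] (b : HilbertBasis ι 𝕜 E)
    {α : Type*} {l : Filter α} {S : α → E →L[𝕜] E} {T : E →L[𝕜] E} {C : ℝ}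
    (hC : ∀ a, ‖S a‖ ≤ C)
    (h : ∀ i j, Tendsto (fun a => inner 𝕜 (b i) (S a (b j))) l (𝓝 (inner 𝕜 (b i) (T (b j))))) :
    Tendsto (fun a => (ContinuousLinearMapWOT.ofCLM (S a) : E →WOT[𝕜] E)) l
      (𝓝 (ContinuousLinearMapWOT.ofCLM T)) := by
  have hb : Dense (Submodule.span 𝕜 (Set.range b) : Set E) :=
    Submodule.dense_iff_topologicalClosure_eq_top.2 b.dense_span
  have hleft (i : ι) (u : E) :
      Tendsto (fun a => inner 𝕜 (b i) (S a u)) l (𝓝 (inner 𝕜 (b i) (T u))) := by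
    refine tendsto_clm_apply_of_dense_span (S := fun a => innerSL 𝕜 (b i) ∘L S a)
      (T := innerSL 𝕜 (b i) ∘L T) (C := C) (fun a => ?_) hb (Set.forall_mem_range.2 (h i)) u
    refine (ContinuousLinearMap.opNorm_comp_le _ _).trans ?_
    rw [innerSL_apply_norm, b.orthonormal.1 i, one_mul]
    exact hC a
  refine ContinuousLinearMapWOT.tendsto_iff_forall_inner_apply_tendsto.2 fun u v => ?_
  have hright : Tendsto (fun a => innerSL 𝕜 (S a u) v) l (𝓝 (innerSL 𝕜 (T u) v)) := by
    refine tendsto_clm_apply_of_dense_span (C := C * ‖u‖) (fun a => ?_) hb ?_ v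
    · rw [innerSL_apply_norm]
      exact (S a).le_of_opNorm_le (hC a) u
    · rintro _ ⟨i, rfl⟩
      simpa only [innerSL_apply_apply, Function.comp_def, inner_conj_symm] using
        ((RCLike.continuous_conj (K := 𝕜)).tendsto _).comp (hleft i u)
  simpa only [innerSL_apply_apply, Function.comp_def, inner_conj_symm,
    ContinuousLinearMapWOT.ofCLM_apply] using
    ((RCLike.continuous_conj (K := 𝕜)).tendsto _).comp hright

end MatrixCoefficients

/-! ### Schur multipliers and Fejér weights -/

section Schur

variable {ι 𝕜 E K : Type*} [RCLike 𝕜] [NormedAddCommGroup E] [InnerProductSpace 𝕜 E]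
  [NormedAddCommGroup K] [InnerProductSpace 𝕜 K]

theorem norm_sq_sum_smul_orthonormal {v : ι → E} (hv : Orthonormal 𝕜 v) (s : Finset ι)
    (a : ι → 𝕜) : ‖∑ i ∈ s, a i • v i‖ ^ 2 = ∑ i ∈ s, ‖a i‖ ^ 2 := by
  have h := hv.inner_sum a a s
  simp only [inner_self_eq_norm_sq_to_K, RCLike.conj_mul] at h
  exact_mod_cast h

theorem norm_le_of_norm_inner_span_le (b : HilbertBasis ι 𝕜 E) {S : E →L[𝕜] E} {C : ℝ}
    (hC : 0 ≤ C)
    (h : ∀ u ∈ Submodule.span 𝕜 (Set.range b), ∀ v ∈ Submodule.span 𝕜 (Set.range b),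
      ‖inner 𝕜 v (S u)‖ ≤ C * ‖u‖ * ‖v‖) : ‖S‖ ≤ C := by
  have hb : Dense (Submodule.span 𝕜 (Set.range b) : Set E) :=
    Submodule.dense_iff_topologicalClosure_eq_top.2 b.dense_span
  have hall (u v : E) : ‖inner 𝕜 v (S u)‖ ≤ C * ‖u‖ * ‖v‖ :=
    isClosed_property2 hb.denseRange_val
      (p := fun u v : E => ‖inner 𝕜 v (S u)‖ ≤ C * ‖u‖ * ‖v‖)
      (isClosed_le (by fun_prop) (by fun_prop)) (fun u v => h u u.2 v v.2) u v
  refine ContinuousLinearMap.opNorm_le_of_re_inner_le (𝕜 := 𝕜) hC fun u v hu hv => ?_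
  rw [← inner_conj_symm, RCLike.conj_re]
  simpa only [hu, hv, mul_one] using (RCLike.re_le_norm _).trans (hall u v)

variable {κ : Type*} [Fintype κ]

theorem sum_norm_sq_sum_inner_smul_le {v : ι → E} (hv : Orthonormal 𝕜 v)
    (e : OrthonormalBasis κ 𝕜 K) {q : ι → K} (hq : ∀ i, ‖q i‖ ≤ 1) (s : Finset ι) (a : ι → 𝕜) :
    ∑ r, ‖∑ i ∈ s, (inner 𝕜 (e r) (q i) * a i) • v i‖ ^ 2 ≤ ‖∑ i ∈ s, a i • v i‖ ^ 2 := by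
  simp only [norm_sq_sum_smul_orthonormal hv, norm_mul, mul_pow]
  rw [Finset.sum_comm]
  refine Finset.sum_le_sum fun i _ => ?_
  rw [← Finset.sum_mul, e.sum_sq_norm_inner_right]
  exact mul_le_of_le_one_left (sq_nonneg _) (pow_le_one₀ (norm_nonneg _) (hq i))

theorem inner_sum_smul_eq_sum_inner (v : ι → E) (e : OrthonormalBasis κ 𝕜 K)
    {S T : E →L[𝕜] E} {p q : ι → K} {s t : Finset ι}
    (h : ∀ i ∈ t, ∀ j ∈ s,
      inner 𝕜 (v i) (S (v j)) = inner 𝕜 (p i) (q j) * inner 𝕜 (v i) (T (v j)))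
    (a c : ι → 𝕜) :
    inner 𝕜 (∑ i ∈ t, c i • v i) (S (∑ j ∈ s, a j • v j)) =
      ∑ r, inner 𝕜 (∑ i ∈ t, (inner 𝕜 (e r) (p i) * c i) • v i)
        (T (∑ j ∈ s, (inner 𝕜 (e r) (q j) * a j) • v j)) := by
  simp only [map_sum, map_smul, sum_inner, inner_sum, inner_smul_left, inner_smul_right,
    map_mul, inner_conj_symm, Finset.mul_sum]
  simp only [Finset.sum_comm (s := Finset.univ)]
  refine Finset.sum_congr rfl fun j hj => Finset.sum_congr rfl fun i hi => ?_
  have hpq : inner 𝕜 (p i) (q j) = ∑ r, inner 𝕜 (p i) (e r) * inner 𝕜 (e r) (q j) :=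
    (e.sum_inner_mul_inner (p i) (q j)).symm
  rw [h i hi j hj, hpq, Finset.sum_mul, Finset.mul_sum, Finset.mul_sum]
  exact Finset.sum_congr rfl fun r _ => by ring

theorem norm_inner_sum_smul_le_of_orthonormalBasis {v : ι → E} (hv : Orthonormal 𝕜 v)
    (e : OrthonormalBasis κ 𝕜 K) {S T : E →L[𝕜] E} {p q : ι → K}
    (hp : ∀ i, ‖p i‖ ≤ 1) (hq : ∀ j, ‖q j‖ ≤ 1) {s t : Finset ι}
    (h : ∀ i ∈ t, ∀ j ∈ s,
      inner 𝕜 (v i) (S (v j)) = inner 𝕜 (p i) (q j) * inner 𝕜 (v i) (T (v j)))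
    (a c : ι → 𝕜) :
    ‖inner 𝕜 (∑ i ∈ t, c i • v i) (S (∑ j ∈ s, a j • v j))‖ ≤
      ‖T‖ * ‖∑ j ∈ s, a j • v j‖ * ‖∑ i ∈ t, c i • v i‖ := by
  rw [inner_sum_smul_eq_sum_inner v e h]
  set x := fun r => ∑ j ∈ s, (inner 𝕜 (e r) (q j) * a j) • v j
  set y := fun r => ∑ i ∈ t, (inner 𝕜 (e r) (p i) * c i) • v i
  calc ‖∑ r, inner 𝕜 (y r) (T (x r))‖
      ≤ ∑ r, ‖T‖ * (‖x r‖ * ‖y r‖) := norm_sum_le_of_le _ fun r _ => by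
        rw [← mul_assoc, mul_comm _ ‖y r‖]
        exact (norm_inner_le_norm _ _).trans
          (mul_le_mul_of_nonneg_left (T.le_opNorm _) (norm_nonneg _))
    _ = ‖T‖ * ∑ r, ‖x r‖ * ‖y r‖ := (Finset.mul_sum _ _ _).symm
    _ ≤ ‖T‖ * (√(∑ r, ‖x r‖ ^ 2) * √(∑ r, ‖y r‖ ^ 2)) := by
        gcongr
        exact Real.sum_mul_le_sqrt_mul_sqrt _ _ _
    _ ≤ ‖T‖ * (‖∑ j ∈ s, a j • v j‖ * ‖∑ i ∈ t, c i • v i‖) := by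
        gcongr
        · exact Real.sqrt_le_iff.2 ⟨norm_nonneg _, sum_norm_sq_sum_inner_smul_le hv e hq s a⟩
        · exact Real.sqrt_le_iff.2 ⟨norm_nonneg _, sum_norm_sq_sum_inner_smul_le hv e hp t c⟩
    _ = ‖T‖ * ‖∑ j ∈ s, a j • v j‖ * ‖∑ i ∈ t, c i • v i‖ := (mul_assoc _ _ _).symm

theorem norm_le_of_schur (b : HilbertBasis ι 𝕜 E) {S T : E →L[𝕜] E} {p q : ι → K}
    (hp : ∀ i, ‖p i‖ ≤ 1) (hq : ∀ j, ‖q j‖ ≤ 1)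
    (h : ∀ i j, inner 𝕜 (b i) (S (b j)) = inner 𝕜 (p i) (q j) * inner 𝕜 (b i) (T (b j))) :
    ‖S‖ ≤ ‖T‖ := by
  classical
  refine norm_le_of_norm_inner_span_le b (norm_nonneg T) fun u hu v hv => ?_
  obtain ⟨a, rfl⟩ := Finsupp.mem_span_range_iff_exists_finsupp.1 hu
  obtain ⟨c, rfl⟩ := Finsupp.mem_span_range_iff_exists_finsupp.1 hv
  -- Projecting the `p i` and `q j` onto the span of the finitely many relevant `q j` does not
  -- change the inner products in `h`, so the target may be assumed finite-dimensional.
  let W : Submodule 𝕜 K := Submodule.span 𝕜 (a.support.image q : Set K)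
  have hproj (w : K) (hw : ‖w‖ ≤ 1) : ‖W.orthogonalProjectionOnto w‖ ≤ 1 :=
    (W.norm_orthogonalProjectionOnto_apply_le w).trans hw
  refine norm_inner_sum_smul_le_of_orthonormalBasis b.orthonormal (stdOrthonormalBasis 𝕜 W)
    (p := fun i => W.orthogonalProjectionOnto (p i))
    (q := fun j => W.orthogonalProjectionOnto (q j))
    (fun i => hproj _ (hp i)) (fun j => hproj _ (hq j)) (fun i _ j hj => ?_) a c
  have hqW : q j ∈ W :=
    Submodule.subset_span (Finset.mem_coe.2 (Finset.mem_image_of_mem q hj))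
  rw [h, W.inner_orthogonalProjectionOnto_eq_of_mem_right,
    Submodule.orthogonalProjectionOnto_mem_subspace_eq_self (⟨q j, hqW⟩ : W)]

end Schur

section FejerWeights

variable {ι 𝕜 E : Type*} [RCLike 𝕜] [NormedAddCommGroup E] [InnerProductSpace 𝕜 E]

variable (𝕜) in
/-- The unit vector `N^{-1/2} (e_d + ⋯ + e_{d+N-1})` of `ℓ²`. Such vectors represent the Fejér
weights `(N - |d - e|) / N` as inner products. -/
def windowVec (N d : ℕ) : lp (fun _ : ℕ => 𝕜) 2 :=
  ((√N : ℝ) : 𝕜)⁻¹ • ∑ r ∈ Finset.Ico d (d + N), lp.single 2 r (1 : 𝕜)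

theorem card_Ico_inter_Ico_add (N d e : ℕ) :
    (Finset.Ico d (d + N) ∩ Finset.Ico e (e + N)).card = N - Nat.dist d e := by
  rw [Finset.Ico_inter_Ico, Nat.card_Ico, Nat.dist]
  omega

theorem inner_windowVec (N d e : ℕ) :
    inner 𝕜 (windowVec 𝕜 N d) (windowVec 𝕜 N e) = ((N - Nat.dist d e : ℕ) : 𝕜) / N := by
  have hsqrt : ((√N : ℝ) : 𝕜) * ((√N : ℝ) : 𝕜) = N := by
    rw [← RCLike.ofReal_mul, Real.mul_self_sqrt N.cast_nonneg, RCLike.ofReal_natCast]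
  have hsum : inner 𝕜 (∑ r ∈ Finset.Ico d (d + N), lp.single (E := fun _ : ℕ => 𝕜) 2 r (1 : 𝕜))
      (∑ r ∈ Finset.Ico e (e + N), lp.single 2 r (1 : 𝕜)) = ((N - Nat.dist d e : ℕ) : 𝕜) := by
    simp only [sum_inner, inner_sum, lp.inner_single_left, lp.single_apply, Pi.single_apply,
      RCLike.inner_apply, map_one, mul_one, Finset.sum_ite_eq']
    rw [Finset.sum_boole, Finset.filter_mem_eq_inter, Finset.inter_comm, card_Ico_inter_Ico_add]
  rw [windowVec, windowVec, inner_smul_left, inner_smul_right, hsum, map_inv₀,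
    RCLike.conj_ofReal, ← mul_assoc, ← mul_inv, hsqrt, inv_mul_eq_div]

theorem norm_windowVec_le_one (N d : ℕ) : ‖windowVec 𝕜 N d‖ ≤ 1 := by
  have h : ‖windowVec 𝕜 N d‖ ^ 2 = (N : ℝ) / N := by
    rw [norm_sq_eq_re_inner (𝕜 := 𝕜), inner_windowVec, Nat.dist_self, Nat.sub_zero,
      ← RCLike.ofReal_natCast, ← RCLike.ofReal_div, RCLike.ofReal_re]
  rw [← sq_le_one_iff₀ (norm_nonneg _), h]
  exact div_self_le_one _

theorem norm_le_of_fejer (b : HilbertBasis ι 𝕜 E) (d : ι → ℕ) {N : ℕ} {S T : E →L[𝕜] E}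
    (h : ∀ i j, inner 𝕜 (b i) (S (b j)) =
      ((N - Nat.dist (d i) (d j) : ℕ) : 𝕜) / N * inner 𝕜 (b i) (T (b j))) : ‖S‖ ≤ ‖T‖ :=
  norm_le_of_schur b (p := fun i => windowVec 𝕜 N (d i)) (q := fun j => windowVec 𝕜 N (d j))
    (fun _ => norm_windowVec_le_one N _) (fun _ => norm_windowVec_le_one N _)
    fun i j => by rw [inner_windowVec, h]

theorem tendsto_fejer_weight (e : ℕ) :
    Tendsto (fun N : ℕ => ((N - e : ℕ) : 𝕜) / N) atTop (𝓝 1) := by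
  have hlim : Tendsto (fun N : ℕ => 1 - (e : 𝕜) / N) atTop (𝓝 (1 - 0)) :=
    (tendsto_const_div_atTop_nhds_zero_nat (e : 𝕜)).const_sub 1
  rw [sub_zero] at hlim
  refine hlim.congr' ?_
  filter_upwards [eventually_ge_atTop e, eventually_gt_atTop 0] with N heN hN
  rw [Nat.cast_sub heN, sub_div, div_self (Nat.cast_ne_zero.2 hN.ne')]

end FejerWeights

/-! ### Summability on the scalar domain -/

section ListSeries

variable {ι : Type*} {g : ι → ℝ}

theorem hasSum_prod_fin_pow (hg : ∀ i, 0 ≤ g i) {s : ℝ} (hs : HasSum g s) (j : ℕ) :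
    HasSum (fun v : Fin j → ι => ∏ i, g (v i)) (s ^ j) := by
  induction j with
  | zero => simp
  | succ j ih =>
    have hprod (v : Fin j → ι) : 0 ≤ ∏ i, g (v i) := Finset.prod_nonneg fun i _ => hg (v i)
    have hmul := HasSum.mul hs ih <| Summable.mul_of_nonneg (f := g)
      (g := fun v : Fin j → ι => ∏ i, g (v i)) hs.summable ih.summable hg hprod
    rw [← (Fin.consEquiv fun _ : Fin (j + 1) => ι).hasSum_iff, pow_succ']
    refine hmul.congr_fun fun p => ?_
    simp [Fin.consEquiv, Fin.prod_univ_succ]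

theorem summable_list_prod_mul_choose (hg : ∀ i, 0 ≤ g i) (hs : Summable g)
    (hlt : ∑' i, g i < 1) (m : ℕ) :
    Summable fun l : List ι => (l.map g).prod * ((l.length + m).choose m : ℝ) := by
  have hpi (j : ℕ) := hasSum_prod_fin_pow hg hs.hasSum j
  have hgeom := summable_choose_mul_geometric_of_norm_lt_one m (r := ∑' i, g i)
    (by rwa [Real.norm_of_nonneg (tsum_nonneg hg)])
  have hsigma : Summable fun p : Σ j, Fin j → ι =>
      (∏ i, g (p.2 i)) * ((p.1 + m).choose m : ℝ) := by
    have hnonneg (p : Σ j, Fin j → ι) : 0 ≤ (∏ i, g (p.2 i)) * ((p.1 + m).choose m : ℝ) :=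
      mul_nonneg (Finset.prod_nonneg fun i _ => hg _) (Nat.cast_nonneg _)
    refine (summable_sigma_of_nonneg hnonneg).2
      ⟨fun j => (hpi j).summable.mul_right ((j + m).choose m : ℝ), hgeom.congr fun j => ?_⟩
    change _ = ∑' v : Fin j → ι, (∏ i, g (v i)) * ((j + m).choose m : ℝ)
    rw [tsum_mul_right, (hpi j).tsum_eq, mul_comm]
  rw [← (List.equivSigmaTuple (α := ι)).symm.summable_iff]
  refine hsigma.congr fun p => ?_
  simp [List.equivSigmaTuple, List.map_ofFn, List.prod_ofFn]

end ListSeries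

theorem splitWrtComposition_injective {ι : Type*} : Function.Injective
    fun p : Σ α : List ι, Composition α.length => p.1.splitWrtComposition p.2 := by
  rintro ⟨α, c⟩ ⟨β, d⟩ h
  replace h : α.splitWrtComposition c = β.splitWrtComposition d := h
  obtain rfl : α = β := by
    rw [← α.flatten_splitWrtComposition c, h, List.flatten_splitWrtComposition]
  obtain rfl : c = d := by
    refine Composition.ext ?_
    rw [← α.map_length_splitWrtComposition c, h, List.map_length_splitWrtComposition]
  rfl

variable {n : ℕ} {H : Type*} [NormedAddCommGroup H] [InnerProductSpace ℂ H] [CompleteSpace H]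

theorem evalWord_cons {R : Type*} [Monoid R] (x : Fin n → R) (i : Fin n) (α : Word n) :
    evalWord x (i :: α) = x i * evalWord x α := by
  rw [evalWord, List.map_cons, List.prod_cons, evalWord]

theorem evalWord_flatten {R : Type*} [Monoid R] (x : Fin n → R) (l : List (Word n)) :
    evalWord x l.flatten = (l.map (evalWord x)).prod := by
  rw [evalWord, List.map_flatten, List.prod_flatten, List.map_map]
  rfl

theorem prod_map_coeff_mul_norm_sq (f : PosRegFreeHol n H) (x : Fin n → ℂ) (l : List (Word n)) :
    (l.map fun γ => f.coeff γ * ‖evalWord x γ‖ ^ 2).prod =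
      (l.map f.coeff).prod * ‖evalWord x l.flatten‖ ^ 2 := by
  rw [evalWord_flatten]
  induction l with
  | nil => simp
  | cons α l ih =>
    simp only [List.map_cons, List.prod_cons, ih, norm_mul]
    ring

theorem summable_bCoeff_mul_norm_sq (f : PosRegFreeHol n H) (m : ℕ) {x : Fin n → ℂ}
    (hx : x ∈ scalarDomain f) :
    Summable fun α : Word n => bCoeff f m α * ‖evalWord x α‖ ^ 2 := by
  have hsum := ((summable_list_prod_mul_choose
    (fun γ => mul_nonneg (f.coeff_nonneg γ) (sq_nonneg _)) hx.1 hx.2 (m - 1)).comp_injective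
      splitWrtComposition_injective).sigma
  refine hsum.congr fun α => ?_
  rw [tsum_fintype, bCoeff, Finset.sum_mul]
  refine Finset.sum_congr rfl fun c _ => ?_
  have hchoose : (c.length + m - 1).choose (m - 1) = (c.length + (m - 1)).choose (m - 1) := by
    cases m with
    | zero => simp
    | succ m => rfl
  rw [Function.comp_apply, prod_map_coeff_mul_norm_sq, List.flatten_splitWrtComposition,
    List.length_splitWrtComposition, hchoose, mul_right_comm]

/-- The type of a word: the multi-index that counts the occurrences of the generators in it. -/
def wordType (α : Word n) : Fin n →₀ ℕ := Multiset.toFinsupp (α : Multiset (Fin n))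

theorem wordType_apply (α : Word n) (i : Fin n) : wordType α i = α.count i := by
  rw [wordType, Multiset.toFinsupp_apply, Multiset.coe_count]

theorem mem_wordsOfType_iff_wordType_eq (k : Fin n →₀ ℕ) (α : Word n) :
    α ∈ wordsOfType k ↔ wordType α = k := by
  simp only [mem_wordsOfType, Finsupp.ext_iff, wordType_apply]

theorem monomialAt_zero (x : Fin n → ℂ) : monomialAt x 0 = 1 := by
  simp [monomialAt]

theorem monomialAt_add (x : Fin n → ℂ) (k l : Fin n →₀ ℕ) :
    monomialAt x (k + l) = monomialAt x k * monomialAt x l := by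
  simp [monomialAt, pow_add, Finset.prod_mul_distrib]

theorem evalWord_of_mem_wordsOfType (x : Fin n → ℂ) {k : Fin n →₀ ℕ} {α : Word n}
    (h : α ∈ wordsOfType k) : evalWord x α = monomialAt x k := by
  rw [evalWord, Finset.prod_list_map_count, monomialAt]
  simp only [← (mem_wordsOfType k α).1 h]
  refine Finset.prod_subset (Finset.subset_univ _) fun i _ hi => ?_
  rw [List.count_eq_zero.2 fun hmem => hi (List.mem_toFinset.2 hmem), pow_zero]

theorem hasSum_sum_wordsOfType {E : Type*} [AddCommMonoid E] [TopologicalSpace E] [ContinuousAdd E]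
    [RegularSpace E] {F : Word n → E} {a : E} (h : HasSum F a) :
    HasSum (fun k => ∑ α ∈ wordsOfType k, F α) a := by
  refine ((Equiv.sigmaFiberEquiv (wordType (n := n))).hasSum_iff.2 h).sigma fun k => ?_
  exact (Equiv.subtypeEquivRight fun α => (mem_wordsOfType_iff_wordType_eq k α).symm).hasSum_iff.2
    (Finset.hasSum (wordsOfType k) F)

theorem summable_gammaCoeff_mul_norm_sq (f : PosRegFreeHol n H) (m : ℕ) {x : Fin n → ℂ}
    (hx : x ∈ scalarDomain f) :
    Summable fun k => gammaCoeff f m k * ‖monomialAt x k‖ ^ 2 := by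
  refine (hasSum_sum_wordsOfType (summable_bCoeff_mul_norm_sq f m hx).hasSum).summable.congr
    fun k => ?_
  rw [gammaCoeff, Finset.sum_mul]
  exact Finset.sum_congr rfl fun α hα => by rw [evalWord_of_mem_wordsOfType x hα]

/-! ### The Hilbert space `H²` -/

/-- The sequence `(√γ_k conj(λ^k))_k` of `ℓ²`: the coordinates of the reproducing kernel of `H²`
at `λ`. -/
def kernelSeq (f : PosRegFreeHol n H) (m : ℕ) (x : scalarDomain f) :
    lp (fun _ : Fin n →₀ ℕ => ℂ) 2 :=
  ⟨fun k => conj ((√(gammaCoeff f m k) : ℂ) * monomialAt (x : Fin n → ℂ) k),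
    memℓp_gen <| (summable_gammaCoeff_mul_norm_sq f m x.2).congr fun k => by
      simp [mul_pow, Real.sq_sqrt (gammaCoeff_pos f m k).le]⟩

theorem kernelSeq_apply (f : PosRegFreeHol n H) (m : ℕ) (x : scalarDomain f) (k : Fin n →₀ ℕ) :
    kernelSeq f m x k = conj ((√(gammaCoeff f m k) : ℂ) * monomialAt (x : Fin n → ℂ) k) :=
  rfl

theorem hasSum_inner_kernelSeq (f : PosRegFreeHol n H) (m : ℕ) (x : scalarDomain f)
    (z : lp (fun _ : Fin n →₀ ℕ => ℂ) 2) :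
    HasSum (fun k => z k * (√(gammaCoeff f m k) : ℂ) * monomialAt (x : Fin n → ℂ) k)
      (inner ℂ (kernelSeq f m x) z) := by
  simpa only [RCLike.inner_apply, kernelSeq_apply, Complex.conj_conj, mul_assoc] using
    lp.hasSum_inner (𝕜 := ℂ) (kernelSeq f m x) z

theorem sqrt_gammaCoeff_ne_zero (f : PosRegFreeHol n H) (m : ℕ) (k : Fin n →₀ ℕ) :
    (√(gammaCoeff f m k) : ℂ) ≠ 0 :=
  Complex.ofReal_ne_zero.2 (Real.sqrt_pos.2 (gammaCoeff_pos f m k)).ne'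

namespace HardySpace

variable [Nontrivial H] {f : PosRegFreeHol n H} {m : ℕ}

theorem coef_eq_of_hasSum (φ : HardySpace f m) (c : (Fin n →₀ ℕ) → ℂ)
    (h : ∀ x : scalarDomain f, HasSum (fun k => c k * monomialAt (x : Fin n → ℂ) k) (φ x)) :
    coef φ = c := by
  refine sub_eq_zero.1 (powerSeries_unique f _ fun x hx => ?_)
  simpa only [Pi.sub_apply, sub_mul, sub_self] using
    ((coef_spec φ).hasSum ⟨x, hx⟩).sub (h ⟨x, hx⟩)

theorem coefMap_surjective : Function.Surjective (coefMap f m) := by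
  intro z
  have hz (k : Fin n →₀ ℕ) : z k * (√(gammaCoeff f m k) : ℂ) / (√(gammaCoeff f m k) : ℂ) = z k :=
    mul_div_cancel_right₀ _ (sqrt_gammaCoeff_ne_zero f m k)
  have hrep : IsPowerSeriesRep f m (fun x => inner ℂ (kernelSeq f m x) z)
      fun k => z k * (√(gammaCoeff f m k) : ℂ) :=
    ⟨(memℓp_iff_summable f m _).1 (by simpa only [hz] using lp.memℓp z), fun x =>
      hasSum_inner_kernelSeq f m x z⟩
  let φ : HardySpace f m := ⟨_, _, hrep⟩
  refine ⟨φ, ?_⟩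
  ext k
  change coef φ k / (√(gammaCoeff f m k) : ℂ) = z k
  rw [coef_eq_of_hasSum φ _ hrep.hasSum, hz]

variable (f m) in
/-- The unitary operator `φ ↦ (c_k / √γ_k)_k` from `H²` onto `ℓ²`. -/
def coefEquiv : HardySpace f m ≃ₗᵢ[ℂ] lp (fun _ : Fin n →₀ ℕ => ℂ) 2 where
  toLinearEquiv := LinearEquiv.ofBijective (coefMap f m) ⟨coefMap_injective, coefMap_surjective⟩
  norm_map' _ := rfl

theorem coefEquiv_apply (φ : HardySpace f m) (k : Fin n →₀ ℕ) :
    coefEquiv f m φ k = coef φ k / (√(gammaCoeff f m k) : ℂ) := rfl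

instance instCompleteSpace : CompleteSpace (HardySpace f m) :=
  (coefEquiv f m).toIsometryEquiv.completeSpace

variable (m) in
/-- The reproducing kernel of `H²` at a point of the scalar domain. -/
def reproducingKernel (x : scalarDomain f) : HardySpace f m :=
  (coefEquiv f m).symm (kernelSeq f m x)

theorem inner_reproducingKernel (x : scalarDomain f) (φ : HardySpace f m) :
    inner ℂ (reproducingKernel m x) φ = φ x := by
  rw [reproducingKernel, ← (coefEquiv f m).inner_map_map, LinearIsometryEquiv.apply_symm_apply]
  refine (hasSum_inner_kernelSeq f m x _).unique ?_
  simpa only [coefEquiv_apply, div_mul_cancel₀ _ (sqrt_gammaCoeff_ne_zero f m _)] using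
    (coef_spec φ).hasSum x

variable (f m) in
/-- The orthonormal basis `(√γ_k λ^k)_k` of `H²`. -/
def monomialBasis : HilbertBasis (Fin n →₀ ℕ) ℂ (HardySpace f m) :=
  HilbertBasis.ofRepr (coefEquiv f m)

theorem inner_monomialBasis (k : Fin n →₀ ℕ) (φ : HardySpace f m) :
    inner ℂ (monomialBasis f m k) φ = coef φ k / (√(gammaCoeff f m k) : ℂ) := by
  rw [← HilbertBasis.repr_apply_apply, monomialBasis, coefEquiv_apply]

theorem monomialBasis_apply (k : Fin n →₀ ℕ) (x : scalarDomain f) :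
    monomialBasis f m k x = (√(gammaCoeff f m k) : ℂ) * monomialAt (x : Fin n → ℂ) k := by
  rw [← inner_reproducingKernel, ← inner_conj_symm, ← HilbertBasis.repr_apply_apply, monomialBasis,
    reproducingKernel, LinearIsometryEquiv.apply_symm_apply, kernelSeq_apply, Complex.conj_conj]

end HardySpace

/-! ### The symmetric weighted Fock space -/

section SymmetricFockSpace

variable (f : PosRegFreeHol n H) (m : ℕ)

/-- The vector `z_λ = ∑_α √b_α conj(λ_α) e_α` of the full Fock space. -/
def fockKernel (x : scalarDomain f) : Fock n :=
  ⟨fun α => conj ((√(bCoeff f m α) : ℂ) * evalWord (x : Fin n → ℂ) α),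
    memℓp_gen <| (summable_bCoeff_mul_norm_sq f m x.2).congr fun α => by
      simp [mul_pow, Real.sq_sqrt (bCoeff_nonneg f m α)]⟩

theorem fockKernel_apply (x : scalarDomain f) (α : Word n) :
    fockKernel f m x α = conj ((√(bCoeff f m α) : ℂ) * evalWord (x : Fin n → ℂ) α) := rfl

theorem hasSum_inner_fockKernel (x : scalarDomain f) (φ : Fock n) :
    HasSum (fun α => φ α * ((√(bCoeff f m α) : ℂ) * evalWord (x : Fin n → ℂ) α))
      (inner ℂ (fockKernel f m x) φ) := by
  simpa only [RCLike.inner_apply, fockKernel_apply, Complex.conj_conj] using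
    lp.hasSum_inner (𝕜 := ℂ) (fockKernel f m x) φ

variable {f} in
theorem inner_fockKernel_creation (i : Fin n) (φ : Fock n) (x : scalarDomain f) :
    inner ℂ (fockKernel f m x) (creation f m i φ) =
      (x : Fin n → ℂ) i * inner ℂ (fockKernel f m x) φ := by
  have happ (β : Word n) : creation f m i φ β = creationFun f m i φ β := rfl
  have hcons : Function.Injective fun α : Word n => i :: α := List.cons_injective
  have hsupp (β : Word n) (hβ : β ∉ Set.range fun α : Word n => i :: α) :
      creationFun f m i φ β = 0 := by
    rcases β with _ | ⟨j, α⟩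
    · rfl
    · exact if_neg fun hj => hβ ⟨α, by rw [hj]⟩
  have h := hasSum_inner_fockKernel f m x (creation f m i φ)
  rw [← hcons.hasSum_iff fun β hβ => by rw [happ, hsupp β hβ, zero_mul]] at h
  refine h.unique (((hasSum_inner_fockKernel f m x φ).mul_left _).congr_fun fun α => ?_)
  have hb : (√(bCoeff f m (i :: α)) : ℂ) ≠ 0 :=
    Complex.ofReal_ne_zero.2 (Real.sqrt_pos.2 (bCoeff_pos f m _)).ne'
  simp only [Function.comp_apply, happ, evalWord_cons, creationFun, if_true, Complex.ofReal_div]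
  field_simp

theorem gammaCoeff_ne_zero (k : Fin n →₀ ℕ) : (gammaCoeff f m k : ℂ) ≠ 0 :=
  Complex.ofReal_ne_zero.2 (gammaCoeff_pos f m k).ne'

theorem inner_symVec (k : Fin n →₀ ℕ) (φ : Fock n) :
    inner ℂ (symVec f m k) φ =
      (gammaCoeff f m k : ℂ)⁻¹ * ∑ α ∈ wordsOfType k, (√(bCoeff f m α) : ℂ) * φ α := by
  simp only [symVec, basisVec, inner_smul_left, sum_inner, lp.inner_single_left,
    RCLike.inner_apply, map_one, mul_one, map_inv₀, Complex.conj_ofReal]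

theorem symVec_apply (k : Fin n →₀ ℕ) (α : Word n) :
    symVec f m k α =
      if wordType α = k then (gammaCoeff f m k : ℂ)⁻¹ * (√(bCoeff f m α) : ℂ) else 0 := by
  have h : symVec f m k α = conj (inner ℂ (symVec f m k) (basisVec α)) := by
    rw [inner_conj_symm, basisVec, lp.inner_single_left, RCLike.inner_apply, map_one, mul_one]
  rw [h, inner_symVec]
  simp only [basisVec, lp.single_apply, Pi.single_apply, mul_ite, mul_one, mul_zero,
    Finset.sum_ite_eq', mem_wordsOfType_iff_wordType_eq]
  split_ifs <;> simp

theorem inner_symVec_symVec (k l : Fin n →₀ ℕ) :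
    inner ℂ (symVec f m k) (symVec f m l) = if k = l then (gammaCoeff f m k : ℂ)⁻¹ else 0 := by
  rw [inner_symVec]
  split_ifs with hkl
  · subst hkl
    have hterm : ∀ α ∈ wordsOfType k, (√(bCoeff f m α) : ℂ) * symVec f m k α =
        (gammaCoeff f m k : ℂ)⁻¹ * (bCoeff f m α : ℂ) := fun α hα => by
      rw [symVec_apply, if_pos ((mem_wordsOfType_iff_wordType_eq k α).1 hα), mul_left_comm,
        ← Complex.ofReal_mul, Real.mul_self_sqrt (bCoeff_nonneg f m α)]
    rw [Finset.sum_congr rfl hterm, ← Finset.mul_sum, ← Complex.ofReal_sum, ← gammaCoeff,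
      inv_mul_cancel₀ (gammaCoeff_ne_zero f m k), mul_one]
  · refine mul_eq_zero_of_right _ (Finset.sum_eq_zero fun α hα => ?_)
    rw [symVec_apply, (mem_wordsOfType_iff_wordType_eq k α).1 hα, if_neg hkl, mul_zero]

theorem hasSum_inner_symVec_mul_monomialAt (x : scalarDomain f) (φ : Fock n) :
    HasSum (fun k => (gammaCoeff f m k : ℂ) * inner ℂ (symVec f m k) φ *
      monomialAt (x : Fin n → ℂ) k) (inner ℂ (fockKernel f m x) φ) := by
  refine (hasSum_sum_wordsOfType (hasSum_inner_fockKernel f m x φ)).congr_fun fun k => ?_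
  rw [inner_symVec, mul_inv_cancel_left₀ (gammaCoeff_ne_zero f m k), Finset.sum_mul]
  refine Finset.sum_congr rfl fun α hα => ?_
  rw [evalWord_of_mem_wordsOfType _ hα]
  ring

theorem mem_orthogonal_symFock_iff (φ : Fock n) :
    φ ∈ (symFock f m)ᗮ ↔ ∀ k, inner ℂ (symVec f m k) φ = 0 := by
  rw [symFock, Submodule.orthogonal_closure, Submodule.mem_orthogonal]
  refine ⟨fun h k => h _ (Submodule.subset_span ⟨k, rfl⟩), fun h u hu => ?_⟩
  have hle : Submodule.span ℂ (Set.range (symVec f m)) ≤ (ℂ ∙ φ)ᗮ :=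
    Submodule.span_le.2 <| Set.range_subset_iff.2 fun k =>
      Submodule.mem_orthogonal_singleton_iff_inner_left.2 (h k)
  exact Submodule.mem_orthogonal_singleton_iff_inner_left.1 (hle hu)

theorem fockKernel_mem_symFock (x : scalarDomain f) : fockKernel f m x ∈ symFock f m := by
  rw [← (symFock f m).orthogonal_orthogonal, Submodule.mem_orthogonal']
  intro φ hφ
  refine (hasSum_inner_symVec_mul_monomialAt f m x φ).unique (hasSum_zero.congr_fun fun k => ?_)
  rw [(mem_orthogonal_symFock_iff f m φ).1 hφ k, mul_zero, zero_mul]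

theorem symVec_mem_symFock (k : Fin n →₀ ℕ) : symVec f m k ∈ symFock f m :=
  Submodule.le_topologicalClosure _ (Submodule.subset_span ⟨k, rfl⟩)

/-- The unit vectors `√γ_k w^k` of the symmetric weighted Fock space. -/
def symUnitVec (k : Fin n →₀ ℕ) : symFock f m :=
  ⟨(√(gammaCoeff f m k) : ℂ) • symVec f m k, Submodule.smul_mem _ _ (symVec_mem_symFock f m k)⟩

theorem inner_symUnitVec (k : Fin n →₀ ℕ) (φ : symFock f m) :
    inner ℂ (symUnitVec f m k) φ =
      (√(gammaCoeff f m k) : ℂ) * inner ℂ (symVec f m k) (φ : Fock n) := by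
  rw [Submodule.coe_inner, symUnitVec, inner_smul_left, Complex.conj_ofReal]

theorem orthonormal_symUnitVec : Orthonormal ℂ (symUnitVec f m) := by
  classical
  rw [orthonormal_iff_ite]
  intro k l
  rw [inner_symUnitVec, symUnitVec, inner_smul_right, inner_symVec_symVec]
  split_ifs with hkl
  · rw [← hkl, ← mul_assoc, ← Complex.ofReal_mul, Real.mul_self_sqrt (gammaCoeff_pos f m k).le,
      mul_inv_cancel₀ (gammaCoeff_ne_zero f m k)]
  · rw [mul_zero, mul_zero]

theorem orthogonal_span_symUnitVec : (Submodule.span ℂ (Set.range (symUnitVec f m)))ᗮ = ⊥ := by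
  refine (Submodule.eq_bot_iff _).2 fun φ hφ => ?_
  have hφ' : (φ : Fock n) ∈ (symFock f m)ᗮ := (mem_orthogonal_symFock_iff f m φ).2 fun k => by
    have h : inner ℂ (symUnitVec f m k) φ = 0 := hφ _ (Submodule.subset_span ⟨k, rfl⟩)
    rw [inner_symUnitVec] at h
    exact (mul_eq_zero.1 h).resolve_left (sqrt_gammaCoeff_ne_zero f m k)
  exact Subtype.ext (inner_self_eq_zero.1 (hφ' _ φ.2))

/-- The orthonormal basis `(√γ_k w^k)_k` of the symmetric weighted Fock space. -/
def symBasis : HilbertBasis (Fin n →₀ ℕ) ℂ (symFock f m) :=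
  HilbertBasis.mkOfOrthogonalEqBot (orthonormal_symUnitVec f m) (orthogonal_span_symUnitVec f m)

theorem symBasis_apply (k : Fin n →₀ ℕ) : symBasis f m k = symUnitVec f m k := by
  rw [symBasis, HilbertBasis.coe_mkOfOrthogonalEqBot]

/-! ### The functional representation of the symmetric weighted Fock space -/

variable [Nontrivial H]

/-- The unitary operator from the symmetric weighted Fock space onto `H²` that maps `w^k` to the
monomial `λ^k`. -/
def functionalRep : symFock f m ≃ₗᵢ[ℂ] HardySpace f m :=
  (symBasis f m).repr.trans (HardySpace.monomialBasis f m).repr.symm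

theorem coef_functionalRep (φ : symFock f m) (k : Fin n →₀ ℕ) :
    HardySpace.coef (functionalRep f m φ) k =
      (gammaCoeff f m k : ℂ) * inner ℂ (symVec f m k) (φ : Fock n) := by
  have hinner : inner ℂ (HardySpace.monomialBasis f m k) (functionalRep f m φ) =
      inner ℂ (symUnitVec f m k) φ := by
    rw [← HilbertBasis.repr_apply_apply, functionalRep, LinearIsometryEquiv.trans_apply,
      LinearIsometryEquiv.apply_symm_apply, HilbertBasis.repr_apply_apply, symBasis_apply]
  rw [HardySpace.inner_monomialBasis, inner_symUnitVec,
    div_eq_iff (sqrt_gammaCoeff_ne_zero f m k), mul_right_comm, ← Complex.ofReal_mul,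
    Real.mul_self_sqrt (gammaCoeff_pos f m k).le] at hinner
  exact hinner

theorem functionalRep_apply (φ : symFock f m) (x : scalarDomain f) :
    functionalRep f m φ x = inner ℂ (fockKernel f m x) (φ : Fock n) := by
  have h := (HardySpace.coef_spec (functionalRep f m φ)).hasSum x
  simp only [coef_functionalRep] at h
  exact h.unique (hasSum_inner_symVec_mul_monomialAt f m x φ)

theorem hasSum_functionalRep (φ : symFock f m) (x : scalarDomain f) :
    HasSum (fun α : Word n => (φ : Fock n) α *
      ((√(bCoeff f m α) : ℂ) * evalWord (x : Fin n → ℂ) α)) (functionalRep f m φ x) := by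
  rw [functionalRep_apply]
  exact hasSum_inner_fockKernel f m x φ

theorem functionalRep_symShift (i : Fin n) (φ : symFock f m) (x : scalarDomain f) :
    functionalRep f m (symShift f m i φ) x = (x : Fin n → ℂ) i * functionalRep f m φ x := by
  have h : inner ℂ (fockKernel f m x) (symShift f m i φ : Fock n) =
      inner ℂ (fockKernel f m x) (creation f m i φ) :=
    Submodule.inner_orthogonalProjectionOnto_eq_of_mem_left
      (⟨fockKernel f m x, fockKernel_mem_symFock f m x⟩ : symFock f m) (creation f m i φ)
  rw [functionalRep_apply, functionalRep_apply, h, inner_fockKernel_creation]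

end SymmetricFockSpace

/-! ### Multipliers -/

variable [Nontrivial H] {f : PosRegFreeHol n H} {m : ℕ}

namespace HardySpace

/-- The constant function `1` in `H²`, see `one_apply`. -/
instance instOne : One (HardySpace f m) :=
  ⟨(√(gammaCoeff f m 0) : ℂ)⁻¹ • monomialBasis f m 0⟩

theorem one_apply (x : scalarDomain f) : (1 : HardySpace f m) x = 1 := by
  change ((√(gammaCoeff f m 0) : ℂ)⁻¹ • monomialBasis f m 0) x = 1
  rw [smul_apply, monomialBasis_apply, monomialAt_zero, mul_one,
    inv_mul_cancel₀ (sqrt_gammaCoeff_ne_zero f m 0)]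

end HardySpace

theorem mem_multiplierAlgebra_iff {T : HardySpace f m →L[ℂ] HardySpace f m} :
    T ∈ multiplierAlgebra f m ↔
      ∀ (ψ : HardySpace f m) (x : scalarDomain f), T ψ x = T 1 x * ψ x := by
  refine ⟨?_, fun h => ⟨T 1, h⟩⟩
  rintro ⟨g, hg⟩ ψ x
  rw [hg, hg, HardySpace.one_apply, mul_one]

theorem mem_orthogonal_reproducingKernel_iff {x : scalarDomain f} {φ : HardySpace f m} :
    φ ∈ (ℂ ∙ HardySpace.reproducingKernel m x)ᗮ ↔ φ x = 0 := by
  rw [Submodule.mem_orthogonal_singleton_iff_inner_right, HardySpace.inner_reproducingKernel]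

theorem orthogonal_reproducingKernel_mem_Lat (x : scalarDomain f) :
    (ℂ ∙ HardySpace.reproducingKernel m x)ᗮ ∈
      Lat (multiplierAlgebra f m : Set (HardySpace f m →L[ℂ] HardySpace f m)) := by
  refine ⟨Submodule.isClosed_orthogonal _, ?_⟩
  rintro A ⟨g, hg⟩ φ hφ
  rw [mem_orthogonal_reproducingKernel_iff] at hφ ⊢
  rw [hg, hφ, mul_zero]

variable (f m) in
theorem isReflexive_multiplierAlgebra : IsReflexive (multiplierAlgebra f m) := by
  refine Set.Subset.antisymm (fun T hT M hM => hM.2 T hT) fun T hT =>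
    mem_multiplierAlgebra_iff.2 fun ψ x => ?_
  have hker : ψ - ψ x • 1 ∈ (ℂ ∙ HardySpace.reproducingKernel m x)ᗮ := by
    rw [mem_orthogonal_reproducingKernel_iff, ← HardySpace.inner_reproducingKernel, inner_sub_right,
      inner_smul_right]
    simp only [HardySpace.inner_reproducingKernel, HardySpace.one_apply, mul_one, sub_self]
  have himage := hT _ (orthogonal_reproducingKernel_mem_Lat x) _ hker
  rw [map_sub, map_smul, mem_orthogonal_reproducingKernel_iff,
    ← HardySpace.inner_reproducingKernel, inner_sub_right, inner_smul_right] at himage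
  simp only [HardySpace.inner_reproducingKernel] at himage
  rw [sub_eq_zero.1 himage, mul_comm]

theorem coef_multiplier_monomialBasis {T : HardySpace f m →L[ℂ] HardySpace f m}
    (hT : T ∈ multiplierAlgebra f m) (k l : Fin n →₀ ℕ) :
    (T (HardySpace.monomialBasis f m k)).coef l =
      if k ≤ l then (√(gammaCoeff f m k) : ℂ) * (T 1).coef (l - k) else 0 := by
  refine congrFun (HardySpace.coef_eq_of_hasSum (T (HardySpace.monomialBasis f m k))
    (fun l => if k ≤ l then (√(gammaCoeff f m k) : ℂ) * (T 1).coef (l - k) else 0) fun x => ?_) l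
  rw [← (add_right_injective k).hasSum_iff]
  · rw [mem_multiplierAlgebra_iff.1 hT, HardySpace.monomialBasis_apply, mul_comm]
    refine (((HardySpace.coef_spec (T 1)).hasSum x).mul_left _).congr_fun fun l => ?_
    rw [Function.comp_apply, if_pos le_self_add, add_tsub_cancel_left, monomialAt_add]
    ring
  · intro l hl
    rw [if_neg fun hkl => hl ⟨l - k, add_tsub_cancel_of_le hkl⟩, zero_mul]

theorem inner_monomialBasis_fejer {S T : HardySpace f m →L[ℂ] HardySpace f m}
    (hS : S ∈ multiplierAlgebra f m) (hT : T ∈ multiplierAlgebra f m) {N : ℕ}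
    (hST : ∀ k, (S 1).coef k = ((N - k.degree : ℕ) : ℂ) / N * (T 1).coef k)
    (l k : Fin n →₀ ℕ) :
    inner ℂ (HardySpace.monomialBasis f m l) (S (HardySpace.monomialBasis f m k)) =
      ((N - Nat.dist l.degree k.degree : ℕ) : ℂ) / N *
        inner ℂ (HardySpace.monomialBasis f m l) (T (HardySpace.monomialBasis f m k)) := by
  rw [HardySpace.inner_monomialBasis, HardySpace.inner_monomialBasis,
    coef_multiplier_monomialBasis hS, coef_multiplier_monomialBasis hT]
  split_ifs with hkl
  · have hdegree : (l - k).degree = Nat.dist l.degree k.degree := by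
      rw [Nat.dist_eq_sub_of_le_right (Finsupp.degree_mono hkl),
        ← add_tsub_cancel_right (l - k).degree k.degree, ← map_add, tsub_add_cancel_of_le hkl]
    rw [hST, hdegree]
    ring
  · rw [zero_div, mul_zero]

/-! ### Fejér means of multipliers -/

theorem exists_mem_adjoin_eq_eval_mul {M : Fin n → HardySpace f m →L[ℂ] HardySpace f m}
    (hM : ∀ (i : Fin n) (ψ : HardySpace f m) (x : scalarDomain f),
      M i ψ x = (x : Fin n → ℂ) i * ψ x) (p : MvPolynomial (Fin n) ℂ) :
    ∃ S ∈ Algebra.adjoin ℂ (Set.range M), ∀ (ψ : HardySpace f m) (x : scalarDomain f),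
      S ψ x = MvPolynomial.eval (x : Fin n → ℂ) p * ψ x := by
  induction p using MvPolynomial.induction_on with
  | C a =>
    refine ⟨algebraMap ℂ _ a, Subalgebra.algebraMap_mem _ a, fun ψ x => ?_⟩
    rw [MvPolynomial.eval_C]
    rfl
  | add p q hp hq =>
    obtain ⟨S, hS, hSp⟩ := hp
    obtain ⟨T, hT, hTq⟩ := hq
    refine ⟨S + T, add_mem hS hT, fun ψ x => ?_⟩
    rw [_root_.add_apply, HardySpace.add_apply, hSp, hTq, map_add, add_mul]
  | mul_X p i hp =>
    obtain ⟨S, hS, hSp⟩ := hp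
    refine ⟨S * M i, mul_mem hS (Algebra.subset_adjoin ⟨i, rfl⟩), fun ψ x => ?_⟩
    rw [mul_apply_eq_comp, hSp, hM, map_mul, MvPolynomial.eval_X, mul_assoc]

/-- The `N`-th Fejér mean of the power series `∑_k c_k λ^k`. -/
def fejerPolynomial (N : ℕ) (c : (Fin n →₀ ℕ) → ℂ) : MvPolynomial (Fin n) ℂ :=
  ∑ k ∈ (Finsupp.finite_of_degree_lt N).toFinset,
    MvPolynomial.monomial k (((N - k.degree : ℕ) : ℂ) / N * c k)

theorem hasSum_eval_fejerPolynomial (N : ℕ) (c : (Fin n →₀ ℕ) → ℂ) (x : Fin n → ℂ) :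
    HasSum (fun k => ((N - k.degree : ℕ) : ℂ) / N * c k * monomialAt x k)
      (MvPolynomial.eval x (fejerPolynomial N c)) := by
  simp only [fejerPolynomial, map_sum, MvPolynomial.eval_monomial,
    Finsupp.prod_fintype _ _ fun _ => pow_zero _]
  refine hasSum_sum_of_ne_finset_zero fun k hk => ?_
  have hdegree : N - k.degree = 0 := by simpa [Nat.sub_eq_zero_iff_le] using hk
  rw [hdegree, Nat.cast_zero, zero_div, zero_mul, zero_mul]

theorem exists_mem_adjoin_coef_eq_fejer {M : Fin n → HardySpace f m →L[ℂ] HardySpace f m}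
    (hM : ∀ (i : Fin n) (ψ : HardySpace f m) (x : scalarDomain f),
      M i ψ x = (x : Fin n → ℂ) i * ψ x) (c : (Fin n →₀ ℕ) → ℂ) (N : ℕ) :
    ∃ S ∈ Algebra.adjoin ℂ (Set.range M), S ∈ multiplierAlgebra f m ∧
      ∀ k, (S 1).coef k = ((N - k.degree : ℕ) : ℂ) / N * c k := by
  obtain ⟨S, hSM, hS⟩ := exists_mem_adjoin_eq_eval_mul hM (fejerPolynomial N c)
  refine ⟨S, hSM, ⟨_, hS⟩, congrFun <| HardySpace.coef_eq_of_hasSum _ _ fun x => ?_⟩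
  rw [hS, HardySpace.one_apply, mul_one]
  exact hasSum_eval_fejerPolynomial N c x

theorem multiplierAlgebra_le_wotClosedAlgebra
    {M : Fin n → HardySpace f m →L[ℂ] HardySpace f m}
    (hM : ∀ (i : Fin n) (ψ : HardySpace f m) (x : scalarDomain f),
      M i ψ x = (x : Fin n → ℂ) i * ψ x) :
    multiplierAlgebra f m ≤ wotClosedAlgebra (Set.range M) := by
  intro T hT
  choose S hSM hS hST using exists_mem_adjoin_coef_eq_fejer hM (T 1).coef
  have hinner (N : ℕ) := inner_monomialBasis_fejer (hS N) hT (hST N)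
  have hnorm (N : ℕ) : ‖S N‖ ≤ ‖T‖ :=
    norm_le_of_fejer (HardySpace.monomialBasis f m) Finsupp.degree (hinner N)
  refine mem_wotClosedAlgebra_of_tendsto (l := atTop) hSM <|
    tendsto_wot_of_tendsto_inner_basis (HardySpace.monomialBasis f m) hnorm fun l k => ?_
  simp only [hinner]
  simpa only [one_mul] using (tendsto_fejer_weight (𝕜 := ℂ) _).mul_const _

theorem multiplierAlgebra_eq_wotClosedAlgebra
    {M : Fin n → HardySpace f m →L[ℂ] HardySpace f m}
    (hM : ∀ (i : Fin n) (ψ : HardySpace f m) (x : scalarDomain f),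
      M i ψ x = (x : Fin n → ℂ) i * ψ x) :
    multiplierAlgebra f m = wotClosedAlgebra (Set.range M) := by
  refine le_antisymm (multiplierAlgebra_le_wotClosedAlgebra hM) <|
    wotClosedAlgebra_le_of_isReflexive ?_ (isReflexive_multiplierAlgebra f m)
  rintro _ ⟨i, rfl⟩
  exact ⟨fun x => (x : Fin n → ℂ) i, hM i⟩

end

end FockDomain

theorem theorem4p5 {n m : ℕ} (hn : 1 ≤ n) (hm : 1 ≤ m)
    {H : Type*} [NormedAddCommGroup H] [InnerProductSpace ℂ H] [CompleteSpace H] [Nontrivial H]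
    (f : PosRegFreeHol n H) :
    ∃ U : symFock f m ≃ₗᵢ[ℂ] HardySpace f m,
      -- `U` is the functional representation `φ(λ) = ⟨φ, z_λ⟩`, `z_λ = ∑_α √b_α conj(λ_α) e_α`
      (∀ (φ : symFock f m) (x : scalarDomain f),
        HasSum (fun α : Word n => (φ : Fock n) α *
          ((Real.sqrt (bCoeff f m α) : ℂ) * evalWord (x : Fin n → ℂ) α)) (U φ x)) ∧
      -- `L_i` is the multiplier by the coordinate function `λ_i`
      (∀ (i : Fin n) (φ : symFock f m) (x : scalarDomain f),
        U (symShift f m i φ) x = (x : Fin n → ℂ) i * U φ x) ∧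
      IsReflexive (multiplierAlgebra f m) ∧
      multiplierAlgebra f m = wotClosedAlgebra (Set.range fun i : Fin n =>
        (U.toContinuousLinearEquiv : symFock f m →L[ℂ] HardySpace f m) ∘L symShift f m i ∘L
          (U.symm.toContinuousLinearEquiv : HardySpace f m →L[ℂ] symFock f m)) := by
  refine ⟨functionalRep f m, hasSum_functionalRep f m, functionalRep_symShift f m,
    isReflexive_multiplierAlgebra f m, multiplierAlgebra_eq_wotClosedAlgebra fun i ψ x => ?_⟩
  change functionalRep f m (symShift f m i ((functionalRep f m).symm ψ)) x = _
  rw [functionalRep_symShift, LinearIsometryEquiv.apply_symm_apply]
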